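/- **Critical knot diagrams of $E=MRE_\delta+U_{x^2}$.** A *knot diagram* is a closed regular plane curve $\gamma:\mathbb R/2\pi\mathbb Z\to\mathbb R^2$ of class $C^2$, of length $2\pi$ and parametrized by arc length, that has only finitely many self-intersections, all of them transversal double points, together with the choice of an upper and a lower strand at each double point. Let $\delta>0$ and put $$E(\gamma)=MRE_\delta(\gamma)+U_{x^2}(\gamma),\qquad U_{x^2}(\gamma)=\int_0^{2\pi}\kappa(t)^2\,dt,\qquad MRE_\delta(\gamma)=\sum_{\ell}\Big(\frac1{A(\ell)}-\frac1\delta\Big),$$ where $\kappa$ is the oriented curvature and the sum is over all alternated cycles $\ell$ of the diagram with $A(\ell)<\delta$. Here a *cycle* is a subset of $\gamma(\mathbb R/2\pi\mathbb Z)$ homeomorphic to the circle, and $A(\ell)$ is the area of the domain that it bounds. The *arcs* of a cycle are the pieces of $\gamma$ into which it is divided by those double points at which it turns from one strand to the other. A cycle is *alternated* if it has at least one arc and each of its arcs starts on an upper strand and ends on a lower strand, or vice versa. A *variation* of a diagram $\gamma$ is a family $(\gamma_h)_{|h|<\varepsilon}$ of knot diagrams (so all of them are of length $2\pi$ and parametrized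 by arc length) with $\gamma_0=\gamma$, such that $\gamma_h$, $\gamma_h'$, $\gamma_h''$ are differentiable in $h$ with derivatives jointly continuous in $(h,t)$, and such that the type (upper or lower) of a strand at a crossing is locally constant as a function of $h$ and of the crossing parameter $t$. The diagram $\gamma$ is *critical* for $E$ if for every variation of it $E(\gamma_h)$ is finite for $h$ near $0$ and the derivative $\frac{d}{dh}E(\gamma_h)\big|_{h=0}$ exists and equals $0$. Then for every knot diagram $\gamma$ that is critical for $E$ at least one of the following holds. 1. $\gamma$ is a circle passed once. 2. $\gamma$ is an $\infty$-shaped curve passed once, that is: * $\gamma$ has exactly one double point $p$, and the two open loops into which $p$ divides $\gamma$ lie strictly on opposite sides of a line through $p$; * there are $\xi\in(0,1)$ and $\theta,t_0\in\mathbb R$ such that, for all $t$, $\gamma'(t+t_0)=\big(\cos(\theta+\alpha(t)),\sin(\theta+\alpha(t))\big)$ with $\alpha(t)=2\arcsin\big(\xi\,\mathrm{sn}(2K(\xi)t/\pi\mid\xi)\big)$. Here $F(\varphi\mid\xi)=\int_0^{\varphi}\frac{ds}{\sqrt{1-\xi^2\sin^2 s}}$, $K(\xi)=F(\pi/2\mid\xi)$,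 and $\mathrm{sn}(u\mid\xi)=\sin\varphi$ for the $\varphi$ with $F(\varphi\mid\xi)=u$. 3. $\gamma$ contains an alternated cycle of area less than $\delta$. -/

import Mathlib

open scoped ENNReal Topology

noncomputable section

/-- A knot diagram in the Euclidean plane, which is identified with `ℂ`: a closed regular plane
curve of class `C²` and length `2π`, parametrized by arc length (as a `2π`-periodic function
on `ℝ`), which has finitely many self-intersections, all of them transversal double points, together
with the information which strand is the upper one at each double point. -/
structure KnotDiagram where
  curve : ℝ → ℂ
  contDiff : ContDiff ℝ 2 curve
  periodic : Function.Periodic curve (2 * Real.pi)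
  unit_speed : ∀ t, ‖deriv curve t‖ = 1
  /-- There are finitely many multiple points. -/
  finite_double : {p : ℂ | ∃ s t, (curve s = p ∧ curve t = p) ∧
    ∀ n : ℤ, t ≠ s + n * (2 * Real.pi)}.Finite
  /-- A multiple point is a double point: among three parameters with the same image, two agree
  modulo `2π`. -/
  double : ∀ s t u, curve s = curve t → curve s = curve u →
    (∃ n : ℤ, t = s + n * (2 * Real.pi)) ∨ (∃ n : ℤ, u = s + n * (2 * Real.pi)) ∨
      ∃ n : ℤ, u = t + n * (2 * Real.pi)
  /-- The two tangent vectors at a double point are linearly independent over `ℝ`. -/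
  transversal : ∀ s t, curve s = curve t → (∀ n : ℤ, t ≠ s + n * (2 * Real.pi)) →
    ((starRingEnd ℂ) (deriv curve s) * deriv curve t).im ≠ 0
  /-- The parameters at which the curve runs through a double point on the upper strand. -/
  upper : Set ℝ
  upper_periodic : ∀ t, t + 2 * Real.pi ∈ upper ↔ t ∈ upper
  upper_double : ∀ s ∈ upper, ∃ t, curve s = curve t ∧ ∀ n : ℤ, t ≠ s + n * (2 * Real.pi)
  /-- At each double point exactly one of the two strands is the upper one. -/
  upper_iff : ∀ s t, curve s = curve t → (∀ n : ℤ, t ≠ s + n * (2 * Real.pi)) →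
    (s ∈ upper ↔ t ∉ upper)

namespace KnotDiagram

/-- The parameter `s` belongs to a double point of the diagram. -/
def IsCrossing (D : KnotDiagram) (s : ℝ) : Prop :=
  ∃ t, D.curve s = D.curve t ∧ ∀ n : ℤ, t ≠ s + n * (2 * Real.pi)

/-- The oriented curvature `det (γ', γ'')` of the curve (which has unit speed). -/
def curvature (D : KnotDiagram) (t : ℝ) : ℝ :=
  ((starRingEnd ℂ) (deriv D.curve t) * deriv (deriv D.curve) t).im

/-- The uniformization functional `U_f`. -/
def uniformization (f : ℝ → ℝ) (D : KnotDiagram) : ℝ :=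
  ∫ t in (0 : ℝ)..(2 * Real.pi), f (D.curvature t)

/-- A cycle of a diagram is a subset of the diagram that is homeomorphic to the circle. -/
def IsCycle (D : KnotDiagram) (C : Set ℂ) : Prop :=
  C ⊆ Set.range D.curve ∧ Nonempty (C ≃ₜ Circle)

/-- The arcs of `C`: the maximal nondegenerate parameter intervals `[a, b]` that the curve maps
into `C`. If `C` is a cycle, then `a` and `b` belong to double points at which the
cycle turns from one strand to the other; a double point that the cycle passes straight through
is interior to an arc. (A cycle which is the whole diagram has no arcs.) -/
def IsArc (D : KnotDiagram) (C : Set ℂ) (a b : ℝ) : Prop :=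
  a < b ∧ D.curve '' Set.Icc a b ⊆ C ∧
    ∀ a' b', a' ≤ a → b ≤ b' → D.curve '' Set.Icc a' b' ⊆ C → a' = a ∧ b' = b

/-- A cycle, composed of arcs, is alternated if each of its arcs starts on an upper strand and ends
on a lower strand, or vice versa. -/
def IsAlternated (D : KnotDiagram) (C : Set ℂ) : Prop :=
  D.IsCycle C ∧ (∃ a b, D.IsArc C a b) ∧
    ∀ a b, D.IsArc C a b → (a ∈ D.upper ↔ b ∉ D.upper)

end KnotDiagram

/-- The area of the domain bounded by `C`, that is, of the union of the bounded
components of the complement of `C`. -/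
def cycleArea (C : Set ℂ) : ℝ≥0∞ :=
  MeasureTheory.volume {z : ℂ | z ∉ C ∧ Bornology.IsBounded (connectedComponentIn Cᶜ z)}

namespace KnotDiagram

/-- The material resistance energy, a sum over the alternated cycles `C` of area `A < δ` of the
positive terms `1 / A - 1 / δ`, with values in `[0, ∞]`. -/
def mre (δ : ℝ) (D : KnotDiagram) : ℝ≥0∞ :=
  ∑' C : {C : Set ℂ // D.IsAlternated C ∧ cycleArea C < ENNReal.ofReal δ},
    ((cycleArea C.1)⁻¹ - (ENNReal.ofReal δ)⁻¹)

/-- The total energy `MRE_δ + U_{x²}`. -/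
def totalEnergy (δ : ℝ) (D : KnotDiagram) : ℝ≥0∞ :=
  D.mre δ + ENNReal.ofReal (D.uniformization fun x => x ^ 2)

/-- A variation of the knot diagram `D`: a family `F h` of knot diagrams, `-ε < h < ε`,
with `F 0 = D`, which is a `C¹` path in the space of curves of class `C²`
(the curves and their first two derivatives in `t` have derivatives in `h` that are jointly
continuous), such that the type of a crossing depends continuously on the crossing. -/
def IsVariation (D : KnotDiagram) (F : ℝ → KnotDiagram) : Prop :=
  F 0 = D ∧ ∃ ε : ℝ, 0 < ε ∧
    (∀ j : ℕ, j ≤ 2 → ∃ V : ℝ × ℝ → ℂ,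
      ContinuousOn V (Set.Ioo (-ε) ε ×ˢ Set.univ) ∧
      ∀ h ∈ Set.Ioo (-ε) ε, ∀ t : ℝ,
        HasDerivAt (fun h' : ℝ => iteratedDeriv j (F h').curve t) (V (h, t)) h) ∧
    ∀ h ∈ Set.Ioo (-ε) ε, ∀ t : ℝ, (F h).IsCrossing t →
      ∀ᶠ p : ℝ × ℝ in 𝓝 (h, t), (F p.1).IsCrossing p.2 →
        (p.2 ∈ (F p.1).upper ↔ t ∈ (F h).upper)

/-- `D` is critical for an energy: along every variation of `D`, the energy is finite near the
parameter `0` and its derivative at `0` exists and vanishes. -/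
def IsCritical (E : KnotDiagram → ℝ≥0∞) (D : KnotDiagram) : Prop :=
  ∀ F : ℝ → KnotDiagram, D.IsVariation F →
    (∀ᶠ h in 𝓝 (0 : ℝ), E (F h) ≠ ∞) ∧ HasDerivAt (fun h => (E (F h)).toReal) 0 0

/-- The curve is a circle passed once. -/
def IsCirclePassedOnce (D : KnotDiagram) : Prop :=
  (∃ (c : ℂ) (r : ℝ), 0 < r ∧ Set.range D.curve = Metric.sphere c r) ∧
    Set.InjOn D.curve (Set.Ico 0 (2 * Real.pi))

end KnotDiagram

/-- The incomplete elliptic integral of the first kind with modulus `m`. -/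
def ellipticF (φ m : ℝ) : ℝ :=
  ∫ t in (0 : ℝ)..φ, 1 / Real.sqrt (1 - m ^ 2 * Real.sin t ^ 2)

/-- The complete elliptic integral of the first kind with modulus `m`. -/
def ellipticK (m : ℝ) : ℝ := ellipticF (Real.pi / 2) m

/-- The Jacobi elliptic sine for a modulus `m` in `(-1, 1)`: `sn (u | m) = sin φ`, where `φ` is the
solution of `u = F (φ | m)`. -/
def jacobiSn (u m : ℝ) : ℝ :=
  Real.sin (Function.invFun (fun φ => ellipticF φ m) u)

namespace KnotDiagram

/-- The curve has the shape of the symbol `∞`, passed once: it has exactly one double point `p`, and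
the two loops into which `p` divides it lie on opposite sides of a line through `p`. -/
def IsFigureEight (D : KnotDiagram) : Prop :=
  ∃ s t : ℝ, s < t ∧ t < s + 2 * Real.pi ∧ D.curve s = D.curve t ∧
    Set.InjOn D.curve (Set.Ico s (s + 2 * Real.pi) \ {t}) ∧
    ∃ u : ℂ, (∀ τ ∈ Set.Ioo s t, 0 < ((starRingEnd ℂ) u * (D.curve τ - D.curve s)).re) ∧
      ∀ τ ∈ Set.Ioo t (s + 2 * Real.pi),
        ((starRingEnd ℂ) u * (D.curve τ - D.curve s)).re < 0

/-- Up to a rotation and a shift of the parameter, the angle `α` of the tangent vector satisfies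
`sin (α / 2) = ξ sn (2 K(ξ) t / π | ξ)`, `|α| < π`, for some modulus `0 < ξ < 1`; the period of the
right side is `2π`. (As the curve is closed, the integral of `cos α` over a period is `0`.) -/
def IsPendulumCurve (D : KnotDiagram) : Prop :=
  ∃ ξ ∈ Set.Ioo (0 : ℝ) 1, ∃ θ t₀ : ℝ, ∀ t : ℝ,
    deriv D.curve (t + t₀) = Complex.exp (Complex.I *
      ((θ + 2 * Real.arcsin (ξ * jacobiSn (2 * ellipticK ξ * t / Real.pi) ξ) : ℝ) : ℂ))

/-- The `∞`-shaped curve, defined by elliptic functions, passed once. -/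
def IsInftyShapedPassedOnce (D : KnotDiagram) : Prop :=
  D.IsFigureEight ∧ D.IsPendulumCurve

end KnotDiagram

end

/-!
If `D` has no alternated cycle of area less than `δ`, its material resistance energy is `0`. As this
energy is nonnegative along every variation, the difference between the total energy and the total
squared curvature `∫ κ²` has a minimum at `D`, so `D` is critical for `∫ κ²` alone
(`hasDerivAt_uniformization_eq_zero`). No continuity of the material resistance energy is
needed.

Enough variations exist. Rotate the tangent vectors by the angles `h η + ⟪γ', W h⟫`, where
the small correction `W h : ℂ` is provided by the implicit function theorem and makes the perturbed
curve close up (`exists_closing_correction`). This keeps the parametrization by arc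
length, and small perturbations of a knot diagram are knot diagrams: by compactness, their double
points are transversal and close to old ones, from which they inherit the crossing type
(`KnotDiagram.exists_family`). If `∫ η γ' = 0`, then `W` vanishes to first order and the first
variation is `2 ∫ κ η'`. Taking for `η'` the difference `ψ` of `κ` and its `L²`-projection onto the
affine functions of position gives `∫ ψ² = 0`, that is, `κ = c + ⟪γ, P⟫`
(`exists_curvature_eq_affine`).

If `P = 0`, the curvature is constant, and the curve is a circle. It is covered once, because the
double points are isolated. If `P ≠ 0`, the angle `α` between the tangent and `i P` satisfies the
pendulum equation `α'' = -‖P‖ sin α`. A rotating pendulum does not give a closed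
curve, since `(sin α / κ)' = cos α + ‖P‖ (sin α / κ)²` would have mean value zero; hence `κ` has a
zero (`exists_curvature_eq_zero`), and by uniqueness of solutions `α` is given by the Jacobi
elliptic sine (`exists_pendulum`). The curve contains exactly one period
of the oscillation (`frequency_eq`). The symmetries of the amplitude function and Rolle's theorem
then determine its shape: both inflection points lie over the double point, and the
sign of the curvature separates the two loops (`isInftyShapedPassedOnce_of_affine`).
-/

noncomputable section

open Filter Set

/-! ### Double pairs of closed plane curves -/

/-- The parameters `s` and `t` are distinct modulo `2π` and have the same image under `c`. -/
def IsDoublePair (c : ℝ → ℂ) (s t : ℝ) : Prop :=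
  c s = c t ∧ ∀ n : ℤ, t ≠ s + n * (2 * Real.pi)

theorem Function.Periodic.add_int_mul_two_pi {c : ℝ → ℂ} (hc : Function.Periodic c (2 * Real.pi))
    (s : ℝ) (n : ℤ) : c (s + n * (2 * Real.pi)) = c s :=
  hc.int_mul n s

namespace IsDoublePair

variable {c : ℝ → ℂ} {s t : ℝ}

theorem symm (h : IsDoublePair c s t) : IsDoublePair c t s := by
  refine ⟨h.1.symm, fun n hn => h.2 (-n) ?_⟩
  push_cast
  linarith

theorem shift (hc : Function.Periodic c (2 * Real.pi)) (h : IsDoublePair c s t) (m n : ℤ) :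
    IsDoublePair c (s + m * (2 * Real.pi)) (t + n * (2 * Real.pi)) := by
  refine ⟨by rw [hc.add_int_mul_two_pi, hc.add_int_mul_two_pi, h.1], fun k hk => h.2 (k + m - n) ?_⟩
  push_cast
  linarith

/-- Both parameters of a double pair can be shifted into `[0, 2π)`. -/
theorem exists_shift (hc : Function.Periodic c (2 * Real.pi)) (h : IsDoublePair c s t) :
    ∃ m n : ℤ, IsDoublePair c (s + m * (2 * Real.pi)) (t + n * (2 * Real.pi)) ∧
      s + m * (2 * Real.pi) ∈ Ico 0 (2 * Real.pi) ∧
      t + n * (2 * Real.pi) ∈ Ico 0 (2 * Real.pi) := by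
  have key : ∀ x : ℝ, ∃ m : ℤ, x + m * (2 * Real.pi) ∈ Ico 0 (2 * Real.pi) := fun x => by
    obtain ⟨m, hm, -⟩ := existsUnique_add_zsmul_mem_Ico Real.two_pi_pos x 0
    exact ⟨m, by simpa using hm⟩
  obtain ⟨m, hm⟩ := key s
  obtain ⟨n, hn⟩ := key t
  exact ⟨m, n, h.shift hc m n, hm, hn⟩

end IsDoublePair

/-- A curve whose velocities at nearby parameters make acute angles is locally injective. -/
theorem eq_of_inner_deriv_pos {c : ℝ → ℂ} (hc : Differentiable ℝ c) {ρ : ℝ}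
    (h : ∀ s x, |x| < ρ → 0 < ((starRingEnd ℂ) (deriv c s) * deriv c (s + x)).re)
    {s t : ℝ} (hst : |s - t| < ρ) (heq : c s = c t) : s = t := by
  wlog hlt : s < t generalizing s t
  · rcases lt_trichotomy s t with h1 | h1 | h1
    · exact this hst heq h1
    · exact h1
    · exact (this (by rwa [abs_sub_comm]) heq.symm h1).symm
  exfalso
  set g : ℝ → ℝ := fun x => ((starRingEnd ℂ) (deriv c s) * c x).re with hg
  have hgd : ∀ x, HasDerivAt g ((starRingEnd ℂ) (deriv c s) * deriv c x).re x := fun x => by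
    have h1 := ((hc x).hasDerivAt.const_mul ((starRingEnd ℂ) (deriv c s)))
    exact (Complex.reCLM.hasFDerivAt.comp_hasDerivAt x h1)
  obtain ⟨x, hx, hx0⟩ := exists_hasDerivAt_eq_zero hlt
    (fun x _ => (hgd x).continuousAt.continuousWithinAt) (show g s = g t by simp only [hg, heq])
    (fun x _ => hgd x)
  have := h s (x - s) (by
    rw [abs_sub_comm, abs_of_pos (sub_pos.2 hlt)] at hst
    rw [abs_of_pos (sub_pos.2 hx.1)]
    linarith [hx.2])
  rw [add_sub_cancel] at this
  exact this.ne' hx0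

/-- A transversal double pair is isolated among all double pairs. -/
theorem eventually_ne_of_transversal {c : ℝ → ℂ} (hc : Differentiable ℝ c) {s t : ℝ}
    (h : ((starRingEnd ℂ) (deriv c s) * deriv c t).im ≠ 0) :
    ∀ᶠ z : ℝ × ℝ in 𝓝[≠] (s, t), c z.1 ≠ c z.2 := by
  set L : ℝ × ℝ →L[ℝ] ℂ := (ContinuousLinearMap.fst ℝ ℝ ℝ).smulRight (deriv c s) -
    (ContinuousLinearMap.snd ℝ ℝ ℝ).smulRight (deriv c t) with hL
  have h1 : HasFDerivAt (fun z : ℝ × ℝ => c z.1 - c z.2) L (s, t) := by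
    have hs : HasFDerivAt (fun z : ℝ × ℝ => c z.1) _ (s, t) :=
      ((hc s).hasDerivAt.hasFDerivAt).comp (s, t) (hasFDerivAt_fst (𝕜 := ℝ) (p := (s, t)))
    have ht : HasFDerivAt (fun z : ℝ × ℝ => c z.2) _ (s, t) :=
      ((hc t).hasDerivAt.hasFDerivAt).comp (s, t) (hasFDerivAt_snd (𝕜 := ℝ) (p := (s, t)))
    refine (hs.sub ht).congr_fderiv ?_
    ext <;> simp [hL]
  have hker : LinearMap.ker (L : ℝ × ℝ →ₗ[ℝ] ℂ) = ⊥ := by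
    rw [LinearMap.ker_eq_bot']
    rintro ⟨a, b⟩ hab
    have hab' : (a : ℂ) * deriv c s - b * deriv c t = 0 := by
      simpa [hL] using hab
    have e1 := congrArg (fun z => ((starRingEnd ℂ) (deriv c s) * z).im) hab'
    have e2 := congrArg (fun z => ((starRingEnd ℂ) (deriv c t) * z).im) hab'
    simp only [Complex.mul_im, Complex.sub_im, Complex.sub_re, Complex.mul_re, Complex.conj_re,
      Complex.conj_im, Complex.ofReal_re, Complex.ofReal_im, Complex.zero_re,
      Complex.zero_im] at e1 e2 h
    have hb : b * ((deriv c s).re * (deriv c t).im + -(deriv c s).im * (deriv c t).re) = 0 := by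
      linear_combination -e1
    have ha : a * ((deriv c s).re * (deriv c t).im + -(deriv c s).im * (deriv c t).re) = 0 := by
      linear_combination -e2
    simp [(mul_eq_zero.1 ha).resolve_right h, (mul_eq_zero.1 hb).resolve_right h]
  obtain ⟨K, -, hK⟩ := LinearMap.exists_antilipschitzWith (L : ℝ × ℝ →ₗ[ℝ] ℂ) hker
  filter_upwards [h1.eventually_ne (c := 0) ⟨K, hK⟩] with z hz
  exact sub_ne_zero.1 hz

/-- A closed, locally injective curve with transversal self-intersections has finitely many of
them. -/
theorem finite_multiple_points {c : ℝ → ℂ} (hc : Differentiable ℝ c)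
    (hper : Function.Periodic c (2 * Real.pi)) {ρ : ℝ} (hρ : 0 < ρ)
    (hinj : ∀ s t, |s - t| < ρ → c s = c t → s = t)
    (htr : ∀ s t, IsDoublePair c s t → ((starRingEnd ℂ) (deriv c s) * deriv c t).im ≠ 0) :
    {p : ℂ | ∃ s t, (c s = p ∧ c t = p) ∧ ∀ n : ℤ, t ≠ s + n * (2 * Real.pi)}.Finite := by
  set K : Set (ℝ × ℝ) := Icc 0 (2 * Real.pi) ×ˢ Icc 0 (2 * Real.pi)
  set Q : Set (ℝ × ℝ) := {z | z ∈ K ∧ IsDoublePair c z.1 z.2}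
  have hQ : Q.Finite := by
    by_contra hinf
    obtain ⟨x, -, hx⟩ := Set.Infinite.exists_accPt_of_subset_isCompact hinf
      (isCompact_Icc.prod isCompact_Icc) (fun z hz => hz.1 : Q ⊆ K)
    rw [accPt_iff_frequently_nhdsNE] at hx
    refine hx ?_
    obtain ⟨s, t⟩ := x
    by_cases hst : c s = c t
    · by_cases hd : ∀ n : ℤ, t ≠ s + n * (2 * Real.pi)
      · filter_upwards [eventually_ne_of_transversal hc (htr s t ⟨hst, hd⟩)] with z hz hzQ
        exact hz hzQ.2.1
      · push Not at hd
        obtain ⟨n, rfl⟩ := hd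
        refine Filter.Eventually.filter_mono nhdsWithin_le_nhds ?_
        have : ∀ᶠ z : ℝ × ℝ in 𝓝 (s, s + n * (2 * Real.pi)),
            |z.1 + n * (2 * Real.pi) - z.2| < ρ := by
          have hcont : ContinuousAt (fun z : ℝ × ℝ => |z.1 + n * (2 * Real.pi) - z.2|)
              (s, s + n * (2 * Real.pi)) := by fun_prop
          exact hcont.eventually (gt_mem_nhds (by simpa using hρ))
        filter_upwards [this] with z hz hzQ
        exact hzQ.2.2 n (hinj _ _ hz (by rw [hper.add_int_mul_two_pi]; exact hzQ.2.1)).symm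
    · refine Filter.Eventually.filter_mono nhdsWithin_le_nhds ?_
      have h1 : ContinuousAt (fun z : ℝ × ℝ => c z.1 - c z.2) (s, t) := by
        have := hc.continuous
        fun_prop
      filter_upwards [h1.eventually_ne (sub_ne_zero.2 hst)] with z hz hzQ
      exact hz (sub_eq_zero.2 hzQ.2.1)
  refine (hQ.image fun z => c z.1).subset ?_
  rintro p ⟨s, t, ⟨hs, ht⟩, hd⟩
  obtain ⟨m, n, h1, h2, h3⟩ := IsDoublePair.exists_shift hper (⟨hs.trans ht.symm, hd⟩ :
    IsDoublePair c s t)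
  exact ⟨(s + m * (2 * Real.pi), t + n * (2 * Real.pi)),
    ⟨⟨Ico_subset_Icc_self h2, Ico_subset_Icc_self h3⟩, h1⟩, by
      simp only [hper.add_int_mul_two_pi, hs]⟩

namespace KnotDiagram

/-- Distinct crossing parameters of a knot diagram are uniformly separated. -/
theorem exists_crossing_separation (D : KnotDiagram) :
    ∃ r > 0, ∀ s t, D.IsCrossing s → D.IsCrossing t → |s - t| < 2 * r → s = t := by
  set X : Set ℝ := {s | D.IsCrossing s ∧ s ∈ Icc (-(2 * Real.pi)) (4 * Real.pi)} with hX
  have hfin : X.Finite := by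
    -- Over each of the finitely many double points lie, modulo `2π`, at most two parameters.
    have h1 : X ⊆ ⋃ p ∈ {p : ℂ | ∃ s t, (D.curve s = p ∧ D.curve t = p) ∧
        ∀ n : ℤ, t ≠ s + n * (2 * Real.pi)}, {s | D.curve s = p ∧
          s ∈ Icc (-(2 * Real.pi)) (4 * Real.pi)} := by
      rintro s ⟨⟨t, hst, hd⟩, hs⟩
      simp only [mem_iUnion]
      exact ⟨D.curve s, ⟨s, t, ⟨rfl, hst.symm⟩, hd⟩, rfl, hs⟩
    refine (D.finite_double.biUnion fun p hp => ?_).subset h1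
    obtain ⟨s, t, ⟨hs, ht⟩, hd⟩ := hp
    have horbit : ∀ x : ℝ, ({y | ∃ n : ℤ, y = x + n * (2 * Real.pi)} ∩
        Icc (-(2 * Real.pi)) (4 * Real.pi)).Finite := fun x => by
      refine ((Set.finite_Icc (⌊(-(2 * Real.pi) - x) / (2 * Real.pi)⌋)
        (⌈(4 * Real.pi - x) / (2 * Real.pi)⌉)).image
          fun n : ℤ => x + n * (2 * Real.pi)).subset ?_
      rintro y ⟨⟨n, rfl⟩, h1, h2⟩
      refine ⟨n, ⟨?_, ?_⟩, rfl⟩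
      · have : ((⌊(-(2 * Real.pi) - x) / (2 * Real.pi)⌋ : ℤ) : ℝ) ≤ n :=
          (Int.floor_le _).trans ((div_le_iff₀ Real.two_pi_pos).2 (by linarith))
        exact_mod_cast this
      · have : (n : ℝ) ≤ ⌈(4 * Real.pi - x) / (2 * Real.pi)⌉ :=
          ((le_div_iff₀ Real.two_pi_pos).2 (by linarith)).trans (Int.le_ceil _)
        exact_mod_cast this
    refine ((horbit s).union (horbit t)).subset ?_
    rintro y ⟨hy, hyI⟩
    rcases D.double s t y (hs.trans ht.symm) (hs.trans hy.symm) with ⟨n, hn⟩ | h | h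
    · exact (hd n hn).elim
    · exact Or.inl ⟨h, hyI⟩
    · exact Or.inr ⟨h, hyI⟩
  obtain ⟨d, hd, hsep⟩ : ∃ d > 0, ∀ s ∈ X, ∀ t ∈ X, |s - t| < d → s = t := by
    have hev : ∀ᶠ d in 𝓝[>] (0 : ℝ), ∀ z ∈ X ×ˢ X, |z.1 - z.2| < d → z.1 = z.2 := by
      rw [(hfin.prod hfin).eventually_all]
      rintro ⟨s, t⟩ -
      by_cases hst : s = t
      · exact Eventually.of_forall fun _ _ => hst
      · have : ∀ᶠ d in 𝓝[>] (0 : ℝ), d < |s - t| :=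
          nhdsWithin_le_nhds (gt_mem_nhds (abs_pos.2 (sub_ne_zero.2 hst)))
        filter_upwards [this] with d hd hlt
        exact absurd hlt hd.le.not_gt
    obtain ⟨d, h1, h2⟩ := (hev.and self_mem_nhdsWithin).exists
    exact ⟨d, h2, fun s hs t ht => h1 (s, t) ⟨hs, ht⟩⟩
  refine ⟨min (d / 2) Real.pi, lt_min (by positivity) Real.pi_pos, fun s t hs ht hst => ?_⟩
  obtain ⟨m, hm, -⟩ := existsUnique_add_zsmul_mem_Ico Real.two_pi_pos s 0
  have hm' : s + m * (2 * Real.pi) ∈ Ico 0 (2 * Real.pi) := by simpa using hm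
  have hshift : ∀ x, D.IsCrossing x → D.IsCrossing (x + m * (2 * Real.pi)) := by
    rintro x ⟨y, hy⟩
    exact ⟨_, IsDoublePair.shift D.periodic hy m 0⟩
  have hlt1 : |s - t| < d := hst.trans_le (by linarith [min_le_left (d / 2) Real.pi])
  have hlt2 : |s - t| < 2 * Real.pi := hst.trans_le (by linarith [min_le_right (d / 2) Real.pi])
  have hpi := Real.pi_pos
  rw [abs_lt] at hlt2
  have := hsep (s + m * (2 * Real.pi)) ⟨hshift s hs, by linarith [hm'.1], by linarith [hm'.2]⟩
    (t + m * (2 * Real.pi)) ⟨hshift t ht, by linarith [hm'.1], by linarith [hm'.2]⟩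
    (by simpa using hlt1)
  linarith

end KnotDiagram

/-! ### Stability of knot diagrams -/

namespace KnotDiagram

/-- Curves that are `C¹`-close to the curve of a knot diagram are injective on all intervals of one
common length. -/
theorem eventually_locally_injective (D : KnotDiagram) (G : ℝ → ℝ → ℂ) (hG0 : G 0 = D.curve)
    (hdiff : ∀ᶠ h in 𝓝 (0 : ℝ), Differentiable ℝ (G h))
    (hper : ∀ᶠ h in 𝓝 (0 : ℝ), Function.Periodic (G h) (2 * Real.pi))
    (hcont' : ∀ t, ContinuousAt (fun p : ℝ × ℝ => deriv (G p.1) p.2) (0, t)) :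
    ∃ ρ > 0, ∀ᶠ h in 𝓝 (0 : ℝ), ∀ s t, |s - t| < ρ → G h s = G h t → s = t := by
  have key : ∀ᶠ z : ℝ × ℝ in 𝓝 (0, 0), ∀ s ∈ Icc 0 (2 * Real.pi),
      0 < ((starRingEnd ℂ) (deriv (G z.1) s) * deriv (G z.1) (s + z.2)).re := by
    refine isCompact_Icc.eventually_forall_of_forall_eventually fun s _ => ?_
    have h1 : ContinuousAt (fun p : (ℝ × ℝ) × ℝ => deriv (G p.1.1) p.2) ((0, 0), s) :=
      ContinuousAt.comp' (f := fun p : (ℝ × ℝ) × ℝ => (p.1.1, p.2))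
        (g := fun p : ℝ × ℝ => deriv (G p.1) p.2) (hcont' s) (by fun_prop)
    have h2 : ContinuousAt (fun p : (ℝ × ℝ) × ℝ => deriv (G p.1.1) (p.2 + p.1.2)) ((0, 0), s) :=
      ContinuousAt.comp' (f := fun p : (ℝ × ℝ) × ℝ => (p.1.1, p.2 + p.1.2))
        (g := fun p : ℝ × ℝ => deriv (G p.1) p.2) (hcont' (s + 0)) (by fun_prop)
    have h3 : ContinuousAt (fun p : (ℝ × ℝ) × ℝ => ((starRingEnd ℂ) (deriv (G p.1.1) p.2) *
        deriv (G p.1.1) (p.2 + p.1.2)).re) ((0, 0), s) :=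
      Complex.continuous_re.continuousAt.comp
        ((Complex.continuous_conj.continuousAt.comp h1).mul h2)
    refine h3.eventually (lt_mem_nhds ?_)
    simp only [add_zero, hG0, ← Complex.normSq_eq_conj_mul_self, Complex.ofReal_re,
      Complex.normSq_eq_norm_sq, D.unit_speed]
    norm_num
  obtain ⟨ρ, hρ, hball⟩ := Metric.eventually_nhds_iff.1 key
  refine ⟨ρ, hρ, ?_⟩
  filter_upwards [Metric.ball_mem_nhds (0 : ℝ) hρ, hdiff, hper] with h hh hd hp s t hst heq
  refine eq_of_inner_deriv_pos hd (ρ := ρ) (fun s x hx => ?_) hst heq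
  have hp' : Function.Periodic (deriv (G h)) (2 * Real.pi) := fun x => by
    rw [← deriv_comp_add_const]
    exact congrArg (fun f => deriv f x) (funext hp)
  obtain ⟨m, hm, -⟩ := existsUnique_add_zsmul_mem_Ico Real.two_pi_pos s 0
  have hm' : s + m * (2 * Real.pi) ∈ Ico 0 (2 * Real.pi) := by simpa using hm
  have := hball (y := (h, x)) (by
    rw [Prod.dist_eq, max_lt_iff]
    exact ⟨hh, by simpa using hx⟩) _ (Ico_subset_Icc_self hm')
  simp only at this
  rwa [add_right_comm, hp'.add_int_mul_two_pi, hp'.add_int_mul_two_pi] at this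

/-- The double pairs of curves that are `C¹`-close to the curve of a knot diagram are close to
double pairs of that diagram, and transversal. -/
theorem eventually_double_pair_near (D : KnotDiagram) (G : ℝ → ℝ → ℂ) (hG0 : G 0 = D.curve)
    (hper : ∀ᶠ h in 𝓝 (0 : ℝ), Function.Periodic (G h) (2 * Real.pi)) {ρ : ℝ} (hρ : 0 < ρ)
    (hinj : ∀ᶠ h in 𝓝 (0 : ℝ), ∀ s t, |s - t| < ρ → G h s = G h t → s = t)
    (hcont : ∀ t, ContinuousAt (fun p : ℝ × ℝ => G p.1 p.2) (0, t))
    (hcont' : ∀ t, ContinuousAt (fun p : ℝ × ℝ => deriv (G p.1) p.2) (0, t)) {r : ℝ}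
    (hr : 0 < r) :
    ∀ᶠ h in 𝓝 (0 : ℝ), ∀ s t, IsDoublePair (G h) s t →
      ((starRingEnd ℂ) (deriv (G h) s) * deriv (G h) t).im ≠ 0 ∧
      ∃ s₀ t₀, IsDoublePair D.curve s₀ t₀ ∧ |s - s₀| < r ∧ |t - t₀| < r := by
  have key : ∀ᶠ h in 𝓝 (0 : ℝ), ∀ z ∈ Icc 0 (2 * Real.pi) ×ˢ Icc 0 (2 * Real.pi),
      IsDoublePair (G h) z.1 z.2 →
      ((starRingEnd ℂ) (deriv (G h) z.1) * deriv (G h) z.2).im ≠ 0 ∧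
      ∃ s₀ t₀, IsDoublePair D.curve s₀ t₀ ∧ |z.1 - s₀| < r ∧ |z.2 - t₀| < r := by
    refine (isCompact_Icc.prod isCompact_Icc).eventually_forall_of_forall_eventually ?_
    rintro ⟨s, t⟩ -
    have hfst : ContinuousAt (fun p : ℝ × ℝ × ℝ => (p.1, p.2.1)) (0, s, t) := by fun_prop
    have hsnd : ContinuousAt (fun p : ℝ × ℝ × ℝ => (p.1, p.2.2)) (0, s, t) := by fun_prop
    by_cases hst : D.curve s = D.curve t
    · by_cases hd : ∀ n : ℤ, t ≠ s + n * (2 * Real.pi)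
      · have h1 : ContinuousAt (fun p : ℝ × ℝ × ℝ => deriv (G p.1) p.2.1) (0, s, t) :=
          ContinuousAt.comp' (f := fun p : ℝ × ℝ × ℝ => (p.1, p.2.1))
            (g := fun p : ℝ × ℝ => deriv (G p.1) p.2) (hcont' s) hfst
        have h2 : ContinuousAt (fun p : ℝ × ℝ × ℝ => deriv (G p.1) p.2.2) (0, s, t) :=
          ContinuousAt.comp' (f := fun p : ℝ × ℝ × ℝ => (p.1, p.2.2))
            (g := fun p : ℝ × ℝ => deriv (G p.1) p.2) (hcont' t) hsnd
        have h3 : ContinuousAt (fun p : ℝ × ℝ × ℝ => ((starRingEnd ℂ) (deriv (G p.1) p.2.1) *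
            deriv (G p.1) p.2.2).im) (0, s, t) :=
          Complex.continuous_im.continuousAt.comp
            ((Complex.continuous_conj.continuousAt.comp h1).mul h2)
        have h4 := h3.eventually_ne (by
          simp only [hG0]
          exact D.transversal s t hst hd)
        have h5 : ∀ᶠ p : ℝ × ℝ × ℝ in 𝓝 (0, s, t), |p.2.1 - s| < r :=
          (show ContinuousAt (fun p : ℝ × ℝ × ℝ => |p.2.1 - s|) (0, s, t) by
            fun_prop).eventually (gt_mem_nhds (by simpa using hr))
        have h6 : ∀ᶠ p : ℝ × ℝ × ℝ in 𝓝 (0, s, t), |p.2.2 - t| < r :=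
          (show ContinuousAt (fun p : ℝ × ℝ × ℝ => |p.2.2 - t|) (0, s, t) by
            fun_prop).eventually (gt_mem_nhds (by simpa using hr))
        filter_upwards [h4, h5, h6] with p hp4 hp5 hp6 _
        exact ⟨hp4, s, t, ⟨hst, hd⟩, hp5, hp6⟩
      · push Not at hd
        obtain ⟨n, rfl⟩ := hd
        have h1 : ∀ᶠ p : ℝ × ℝ × ℝ in 𝓝 (0, s, s + n * (2 * Real.pi)),
            |p.2.1 + n * (2 * Real.pi) - p.2.2| < ρ :=
          (show ContinuousAt (fun p : ℝ × ℝ × ℝ => |p.2.1 + n * (2 * Real.pi) - p.2.2|)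
            (0, s, s + n * (2 * Real.pi)) by
              fun_prop).eventually (gt_mem_nhds (by simpa using hρ))
        have h2 : ∀ᶠ p : ℝ × ℝ × ℝ in 𝓝 (0, s, s + n * (2 * Real.pi)),
            Function.Periodic (G p.1) (2 * Real.pi) ∧
            ∀ s t, |s - t| < ρ → G p.1 s = G p.1 t → s = t :=
          (continuousAt_fst (p := ((0 : ℝ), (s, s + n * (2 * Real.pi))))).eventually
            (hper.and hinj)
        filter_upwards [h1, h2] with p hp1 hp2 hdp
        exact absurd (hp2.2 _ _ hp1 (by rw [hp2.1.add_int_mul_two_pi]; exact hdp.1)).symm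
          (hdp.2 n)
    · have h1 : ContinuousAt (fun p : ℝ × ℝ × ℝ => G p.1 p.2.1) (0, s, t) :=
        ContinuousAt.comp' (f := fun p : ℝ × ℝ × ℝ => (p.1, p.2.1))
          (g := fun p : ℝ × ℝ => G p.1 p.2) (hcont s) hfst
      have h2 : ContinuousAt (fun p : ℝ × ℝ × ℝ => G p.1 p.2.2) (0, s, t) :=
        ContinuousAt.comp' (f := fun p : ℝ × ℝ × ℝ => (p.1, p.2.2))
          (g := fun p : ℝ × ℝ => G p.1 p.2) (hcont t) hsnd
      filter_upwards [(h1.sub h2).eventually_ne (y := 0) (by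
        change G 0 s - G 0 t ≠ 0
        rw [hG0]
        exact sub_ne_zero.2 hst)] with p hp hdp
      exact absurd (sub_eq_zero.2 hdp.1) hp
  filter_upwards [key, hper] with h hh hp s t hst
  obtain ⟨m, n, h1, h2, h3⟩ := hst.exists_shift hp
  have hp' : Function.Periodic (deriv (G h)) (2 * Real.pi) := fun x => by
    rw [← deriv_comp_add_const]
    exact congrArg (fun f => deriv f x) (funext hp)
  obtain ⟨h4, s₀, t₀, h5, h6, h7⟩ := hh (_, _)
    ⟨Ico_subset_Icc_self h2, Ico_subset_Icc_self h3⟩ h1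
  simp only [hp'.add_int_mul_two_pi] at h4 h6 h7
  refine ⟨h4, s₀ + (-m : ℤ) * (2 * Real.pi), t₀ + (-n : ℤ) * (2 * Real.pi),
    h5.shift D.periodic _ _, ?_, ?_⟩
  · convert h6 using 2
    push_cast
    ring
  · convert h7 using 2
    push_cast
    ring

/-- Knot diagrams are stable: a family of closed unit speed curves of class `C²` that depends
continuously on the parameter in the `C¹` sense and starts at the curve of a knot diagram
consists, for small parameters, of curves of knot diagrams whose crossing types
are locally constant. -/
theorem exists_family (D : KnotDiagram) (G : ℝ → ℝ → ℂ) (hG0 : G 0 = D.curve)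
    (hC : ∀ᶠ h in 𝓝 (0 : ℝ), ContDiff ℝ 2 (G h))
    (hper : ∀ᶠ h in 𝓝 (0 : ℝ), Function.Periodic (G h) (2 * Real.pi))
    (hunit : ∀ᶠ h in 𝓝 (0 : ℝ), ∀ t, ‖deriv (G h) t‖ = 1)
    (hcont : ∀ t, ContinuousAt (fun p : ℝ × ℝ => G p.1 p.2) (0, t))
    (hcont' : ∀ t, ContinuousAt (fun p : ℝ × ℝ => deriv (G p.1) p.2) (0, t)) :
    ∃ F : ℝ → KnotDiagram, F 0 = D ∧ ∃ ε > 0, (∀ h ∈ Ioo (-ε) ε, (F h).curve = G h) ∧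
      ∀ h ∈ Ioo (-ε) ε, ∀ t : ℝ, (F h).IsCrossing t →
        ∀ᶠ p : ℝ × ℝ in 𝓝 (h, t), (F p.1).IsCrossing p.2 →
          (p.2 ∈ (F p.1).upper ↔ t ∈ (F h).upper) := by
  have hdiff : ∀ᶠ h in 𝓝 (0 : ℝ), Differentiable ℝ (G h) :=
    hC.mono fun h hh => hh.differentiable (by norm_num)
  obtain ⟨ρ, hρ, hinj⟩ := D.eventually_locally_injective G hG0 hdiff hper hcont'
  obtain ⟨r₁, hr₁, hsep₁⟩ := D.exists_crossing_separation
  obtain ⟨r, hr, hrρ, hrr₁⟩ : ∃ r > 0, 2 * r ≤ ρ ∧ r ≤ r₁ :=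
    ⟨min (ρ / 2) r₁, lt_min (by positivity) hr₁, by linarith [min_le_left (ρ / 2) r₁],
      min_le_right _ _⟩
  have hsep : ∀ {x s t}, D.IsCrossing s → D.IsCrossing t → |x - s| < r → |x - t| < r →
      s = t := by
    intro x s t hs ht h1 h2
    refine hsep₁ s t hs ht ?_
    rw [abs_lt] at *
    constructor <;> linarith
  have hnear := D.eventually_double_pair_near G hG0 hper hρ hinj hcont hcont' hr
  obtain ⟨ε, hε, hball⟩ := Metric.eventually_nhds_iff.1
    (hC.and (hper.and (hunit.and (hinj.and hnear))))
  have hgood : ∀ h ∈ Ioo (-ε) ε, _ := fun h hh => hball (y := h) (by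
    rw [dist_zero_right, Real.norm_eq_abs, abs_lt]; exact hh)
  -- A crossing of a nearby curve inherits its type from the crossing of `D` next to it.
  let U : ℝ → Set ℝ := fun h => {s | (∃ t, IsDoublePair (G h) s t) ∧ ∃ s₀ ∈ D.upper, |s - s₀| < r}
  have hcr : ∀ {s}, s ∈ D.upper → D.IsCrossing s := fun hs => D.upper_double _ hs
  have hU : ∀ {h s s₀}, (∃ t, IsDoublePair (G h) s t) → D.IsCrossing s₀ → |s - s₀| < r →
      (s ∈ U h ↔ s₀ ∈ D.upper) := by
    intro h s s₀ hs hs₀ hlt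
    refine ⟨fun ⟨_, s₁, h1, h2⟩ => ?_, fun h1 => ⟨hs, s₀, h1, hlt⟩⟩
    rwa [hsep hs₀ (hcr h1) hlt h2]
  let F : ℝ → KnotDiagram := fun h => if hh : h ∈ Ioo (-ε) ε then
    { curve := G h
      contDiff := (hgood h hh).1
      periodic := (hgood h hh).2.1
      unit_speed := (hgood h hh).2.2.1
      finite_double := finite_multiple_points ((hgood h hh).1.differentiable (by norm_num))
        (hgood h hh).2.1 hρ (hgood h hh).2.2.2.1 fun s t hst => ((hgood h hh).2.2.2.2 s t hst).1
      double := by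
        intro s t u hst hsu
        by_contra! hcon
        obtain ⟨-, hper, -, hinj, hnear⟩ := hgood h hh
        obtain ⟨-, s₀, t₀, h1, h2, h3⟩ := hnear s t ⟨hst, hcon.1⟩
        obtain ⟨-, s₁, u₀, h4, h5, h6⟩ := hnear s u ⟨hsu, hcon.2.1⟩
        obtain rfl : s₀ = s₁ := hsep ⟨t₀, h1⟩ ⟨u₀, h4⟩ h2 h5
        rcases D.double s₀ t₀ u₀ h1.1 h4.1 with ⟨n, hn⟩ | ⟨n, hn⟩ | ⟨n, rfl⟩
        · exact h1.2 n hn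
        · exact h4.2 n hn
        · refine hcon.2.2 n (hinj u (t + n * (2 * Real.pi)) ?_ ?_)
          · rw [abs_lt] at *
            constructor <;> linarith
          · rw [hper.add_int_mul_two_pi, ← hst, ← hsu]
      transversal := fun s t hst hd => ((hgood h hh).2.2.2.2 s t ⟨hst, hd⟩).1
      upper := U h
      upper_periodic := by
        intro t
        have hp := (hgood h hh).2.1
        have hup : ∀ s, s - 2 * Real.pi ∈ D.upper ↔ s ∈ D.upper := fun s => by
          rw [← D.upper_periodic (s - 2 * Real.pi), sub_add_cancel]
        constructor
        · rintro ⟨⟨u, hu⟩, s₀, h1, h2⟩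
          refine ⟨⟨u, ?_⟩, s₀ - 2 * Real.pi, (hup s₀).2 h1, by
            rwa [← sub_add, ← add_sub_right_comm]⟩
          simpa using hu.shift hp (-1) 0
        · rintro ⟨⟨u, hu⟩, s₀, h1, h2⟩
          refine ⟨⟨u, ?_⟩, s₀ + 2 * Real.pi, (D.upper_periodic s₀).2 h1, by
            rwa [add_sub_add_right_eq_sub]⟩
          simpa using hu.shift hp 1 0
      upper_double := fun s hs => hs.1
      upper_iff := by
        intro s t hst hd
        have hdp : IsDoublePair (G h) s t := ⟨hst, hd⟩
        obtain ⟨-, s₀, t₀, h1, h2, h3⟩ := (hgood h hh).2.2.2.2 s t hdp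
        rw [hU ⟨t, hdp⟩ ⟨t₀, h1⟩ h2, hU ⟨s, hdp.symm⟩ ⟨s₀, h1.symm⟩ h3]
        exact D.upper_iff s₀ t₀ h1.1 h1.2 }
    else D
  have h0 : (0 : ℝ) ∈ Ioo (-ε) ε := ⟨by linarith, hε⟩
  have hFc : ∀ h ∈ Ioo (-ε) ε, (F h).curve = G h := fun h hh => by simp only [F, dif_pos hh]
  have hFu : ∀ h ∈ Ioo (-ε) ε, (F h).upper = U h := fun h hh => by simp only [F, dif_pos hh]
  have hFx : ∀ h ∈ Ioo (-ε) ε, ∀ t, (F h).IsCrossing t → ∃ u, IsDoublePair (G h) t u := by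
    rintro h hh t ⟨u, hu⟩
    rw [hFc h hh] at hu
    exact ⟨u, hu⟩
  refine ⟨F, ?_, ε, hε, hFc, ?_⟩
  · have hu : (F 0).upper = D.upper := by
      rw [hFu 0 h0]
      ext s
      constructor
      · rintro ⟨⟨t, ht⟩, hs⟩
        have ht' : IsDoublePair (G 0) s t := ht
        rw [hG0] at ht
        exact (hU ⟨t, ht'⟩ ⟨t, ht⟩ (by simpa using hr)).1 ⟨⟨t, ht'⟩, hs⟩
      · intro hs
        obtain ⟨t, ht⟩ := hcr hs
        exact ⟨⟨t, by rw [hG0]; exact ht⟩, s, hs, by simpa using hr⟩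
    have hc : (F 0).curve = D.curve := (hFc 0 h0).trans hG0
    generalize F 0 = D' at hu hc
    cases D'
    cases D
    simp only at hu hc
    subst hu hc
    rfl
  · intro h hh t ht
    obtain ⟨u, hu⟩ := hFx h hh t ht
    obtain ⟨-, s₀, u₀, h1, h2, -⟩ := (hgood h hh).2.2.2.2 t u hu
    have e1 : ∀ᶠ p : ℝ × ℝ in 𝓝 (h, t), p.1 ∈ Ioo (-ε) ε :=
      (continuousAt_fst (p := (h, t))).eventually (Ioo_mem_nhds hh.1 hh.2)
    have e2 : ∀ᶠ p : ℝ × ℝ in 𝓝 (h, t), |p.2 - s₀| < r :=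
      (show ContinuousAt (fun p : ℝ × ℝ => |p.2 - s₀|) (h, t) by
        fun_prop).eventually (gt_mem_nhds h2)
    filter_upwards [e1, e2] with p hp1 hp2 hpc
    rw [hFu _ hp1, hFu _ hh, hU ⟨u, hu⟩ ⟨u₀, h1⟩ h2, hU (hFx _ hp1 _ hpc) ⟨u₀, h1⟩ hp2]

end KnotDiagram

/-! ### Perturbation of the tangent vectors -/

/-- Differentiation of a primitive with respect to a parameter. -/
theorem hasFDerivAt_primitive {E F : Type*} [NormedAddCommGroup E] [NormedSpace ℝ E]
    [ProperSpace E] [NormedAddCommGroup F] [NormedSpace ℝ F] {f : E → ℝ → F}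
    {f' : E → ℝ → E →L[ℝ] F} (hf : Continuous f.uncurry) (hf' : Continuous f'.uncurry)
    (hd : ∀ p t, HasFDerivAt (fun q => f q t) (f' p t) p) (p : E) (a b : ℝ) :
    HasFDerivAt (fun q => ∫ t in a..b, f q t) (∫ t in a..b, f' p t) p := by
  have hsec : ∀ q, Continuous (f q) := fun q => hf.uncurry_left q
  have hsec' : ∀ q, Continuous (f' q) := fun q => hf'.uncurry_left q
  obtain ⟨M, hM⟩ := ((isCompact_closedBall p 1).prod
    (isCompact_uIcc (a := a) (b := b))).bddAbove_image hf'.norm.continuousOn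
  refine intervalIntegral.hasFDerivAt_integral_of_dominated_of_fderiv_le (bound := fun _ => M)
    (Metric.closedBall_mem_nhds p one_pos)
    (Eventually.of_forall fun q => (hsec q).aestronglyMeasurable)
    ((hsec p).intervalIntegrable _ _) (hsec' p).aestronglyMeasurable ?_
    (by simp) (Eventually.of_forall fun t _ q _ => hd q t)
  refine Eventually.of_forall fun t ht q hq => hM ⟨(q, t), ⟨hq, uIoc_subset_uIcc ht⟩, rfl⟩

/-- A continuous function whose square has vanishing integral over `[0, 2π]` vanishes there. -/
theorem eq_zero_of_integral_sq_eq_zero {f : ℝ → ℝ} (hf : Continuous f)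
    (h : ∫ t in (0 : ℝ)..(2 * Real.pi), f t ^ 2 = 0) : ∀ t ∈ Icc 0 (2 * Real.pi), f t = 0 := by
  intro t ht
  by_contra hne
  have := intervalIntegral.integral_pos Real.two_pi_pos (f := fun t => f t ^ 2)
    (by fun_prop) (fun x _ => sq_nonneg _) ⟨t, ht, by positivity⟩
  exact this.ne' h

theorem Function.Periodic.eq_zero_of_Icc {f : ℝ → ℝ} (hf : Function.Periodic f (2 * Real.pi))
    (h : ∀ t ∈ Icc 0 (2 * Real.pi), f t = 0) (t : ℝ) : f t = 0 := by
  obtain ⟨s, hs, hst⟩ := hf.exists_mem_Ico₀ Real.two_pi_pos t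
  rw [hst, h s (Ico_subset_Icc_self hs)]

namespace KnotDiagram

variable (D : KnotDiagram)

theorem contDiff_deriv : ContDiff ℝ 1 (deriv D.curve) :=
  (contDiff_succ_iff_deriv (n := 1).1 (by simpa using! D.contDiff)).2.2

theorem hasDerivAt_curve (t : ℝ) : HasDerivAt D.curve (deriv D.curve t) t :=
  (D.contDiff.differentiable (by norm_num) t).hasDerivAt

theorem deriv_periodic : Function.Periodic (deriv D.curve) (2 * Real.pi) := fun t => by
  rw [← deriv_comp_add_const]
  exact congrArg (fun f => deriv f t) (funext D.periodic)

theorem deriv_ne_zero (t : ℝ) : deriv D.curve t ≠ 0 := by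
  rw [← norm_ne_zero_iff, D.unit_speed]
  exact one_ne_zero

theorem conj_mul_self_deriv (t : ℝ) :
    (starRingEnd ℂ) (deriv D.curve t) * deriv D.curve t = 1 := by
  rw [← Complex.normSq_eq_conj_mul_self, Complex.normSq_eq_norm_sq, D.unit_speed]
  norm_num

/-- Frenet equation of a plane curve of unit speed. -/
theorem hasDerivAt_deriv (t : ℝ) :
    HasDerivAt (deriv D.curve) (D.curvature t * Complex.I * deriv D.curve t) t := by
  have h1 : HasDerivAt (deriv D.curve) (deriv (deriv D.curve) t) t :=
    (D.contDiff_deriv.differentiable one_ne_zero t).hasDerivAt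
  have h2 : HasDerivAt (fun t => (starRingEnd ℂ) (deriv D.curve t))
      ((starRingEnd ℂ) (deriv (deriv D.curve) t)) t := h1.star
  have h3 := h2.mul h1
  have h4 : (fun t => (starRingEnd ℂ) (deriv D.curve t)) * deriv D.curve = fun _ => 1 :=
    funext fun t => D.conj_mul_self_deriv t
  rw [h4] at h3
  have h5 := h3.unique (hasDerivAt_const t (1 : ℂ))
  have h6 : (starRingEnd ℂ) (deriv D.curve t) * deriv (deriv D.curve) t =
      D.curvature t * Complex.I := by
    have h7 := congrArg Complex.re h5
    apply Complex.ext
    · simp at h7 ⊢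
      linarith
    · simp [curvature]
  have h8 : deriv (deriv D.curve) t = D.curvature t * Complex.I * deriv D.curve t := by
    rw [← h6, mul_right_comm, D.conj_mul_self_deriv, one_mul]
  rwa [h8] at h1

theorem continuous_curvature : Continuous D.curvature := by
  have h1 := D.contDiff_deriv.continuous
  have h2 := D.contDiff_deriv.continuous_deriv le_rfl
  unfold curvature
  fun_prop

theorem curvature_periodic : Function.Periodic D.curvature (2 * Real.pi) := fun t => by
  have h : Function.Periodic (deriv (deriv D.curve)) (2 * Real.pi) := fun t => by
    rw [← deriv_comp_add_const]
    exact congrArg (fun f => deriv f t) (funext D.deriv_periodic)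
  simp only [curvature, D.deriv_periodic t, h t]

/-- The tangent vectors of a closed curve span the plane. -/
theorem eq_zero_of_inner_deriv_eq_zero {w : ℂ} (h : ∀ t ∈ Icc 0 (2 * Real.pi),
    inner ℝ (deriv D.curve t) w = 0) : w = 0 := by
  have hd : ∀ t, HasDerivAt (fun t => ((starRingEnd ℂ) w * D.curve t).im)
      ((starRingEnd ℂ) w * deriv D.curve t).im t := fun t =>
    Complex.imCLM.hasFDerivAt.comp_hasDerivAt t ((D.hasDerivAt_curve t).const_mul _)
  have h0 : D.curve (2 * Real.pi) = D.curve 0 := by simpa using D.periodic 0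
  obtain ⟨t, ht, ht0⟩ := exists_hasDerivAt_eq_zero Real.two_pi_pos
    (fun t _ => (hd t).continuousAt.continuousWithinAt) (by simp only [h0]) (fun t _ => hd t)
  have h1 := h t (Ioo_subset_Icc_self ht)
  have h2 : (starRingEnd ℂ) w * deriv D.curve t = 0 := by
    apply Complex.ext
    · rw [Complex.inner] at h1
      simp at h1 ⊢
      linarith
    · simpa using ht0
  simpa [D.deriv_ne_zero] using h2

section Perturbation

variable (η ψ : ℝ → ℝ)

/-- The angle by which the tangent vector at `t` is rotated, as a linear function
of `(h, w) : ℝ × ℂ`: the multiple `h` of the angle `η t`, corrected by the component of `w` in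
the direction of the tangent. -/
def rotationAngle (t : ℝ) : ℝ × ℂ →L[ℝ] ℝ :=
  η t • ContinuousLinearMap.fst ℝ ℝ ℂ +
    (innerSL ℝ (deriv D.curve t)).comp (ContinuousLinearMap.snd ℝ ℝ ℂ)

/-- The derivative of `rotationAngle` in `t`, if `ψ` is that of `η`. -/
def rotationAngleDeriv (t : ℝ) : ℝ × ℂ →L[ℝ] ℝ :=
  ψ t • ContinuousLinearMap.fst ℝ ℝ ℂ +
    (innerSL ℝ (D.curvature t * Complex.I * deriv D.curve t)).comp
      (ContinuousLinearMap.snd ℝ ℝ ℂ)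

/-- The tangent vector of the perturbed curve. -/
def rotatedTangent (p : ℝ × ℂ) (t : ℝ) : ℂ :=
  deriv D.curve t * Complex.exp (Complex.I * (D.rotationAngle η t p : ℝ))

/-- The derivative of `rotatedTangent` in the parameter of the perturbation. -/
def rotatedTangentFDeriv (p : ℝ × ℂ) (t : ℝ) : ℝ × ℂ →L[ℝ] ℂ :=
  (D.rotationAngle η t).smulRight (Complex.I * D.rotatedTangent η p t)

/-- The curve with tangent vectors `rotatedTangent` that has the same initial point. -/
def perturbedCurve (p : ℝ × ℂ) (t : ℝ) : ℂ :=
  D.curve 0 + ∫ τ in (0 : ℝ)..t, D.rotatedTangent η p τ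

/-- The curvature of the perturbed curve. -/
def perturbedCurvature (p : ℝ × ℂ) (t : ℝ) : ℝ :=
  D.curvature t + D.rotationAngleDeriv ψ t p

variable {η ψ}

theorem rotationAngle_apply (t : ℝ) (p : ℝ × ℂ) :
    D.rotationAngle η t p = η t * p.1 + inner ℝ (deriv D.curve t) p.2 := by
  simp [rotationAngle]

theorem rotationAngleDeriv_apply (t : ℝ) (p : ℝ × ℂ) :
    D.rotationAngleDeriv ψ t p =
      ψ t * p.1 + inner ℝ (D.curvature t * Complex.I * deriv D.curve t) p.2 := by
  simp [rotationAngleDeriv]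

theorem continuous_rotationAngle (hη : Continuous η) : Continuous (D.rotationAngle η) := by
  have h1 := D.contDiff_deriv.continuous
  have h2 : Continuous fun t => innerSL ℝ (deriv D.curve t) := (innerSL ℝ).continuous.comp h1
  unfold rotationAngle
  fun_prop

theorem continuous_rotationAngleDeriv (hψ : Continuous ψ) :
    Continuous (D.rotationAngleDeriv ψ) := by
  have h1 := D.contDiff_deriv.continuous
  have h0 := D.continuous_curvature
  have h2 : Continuous fun t => innerSL ℝ (D.curvature t * Complex.I * deriv D.curve t) :=
    (innerSL ℝ).continuous.comp (by fun_prop)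
  unfold rotationAngleDeriv
  fun_prop

theorem continuous_rotatedTangent (hη : Continuous η) :
    Continuous (D.rotatedTangent η).uncurry := by
  have h1 := D.contDiff_deriv.continuous
  have h2 := D.continuous_rotationAngle hη
  have h3 : Continuous fun p : (ℝ × ℂ) × ℝ => D.rotationAngle η p.2 p.1 :=
    (h2.comp continuous_snd).clm_apply continuous_fst
  unfold Function.uncurry rotatedTangent
  fun_prop

theorem continuous_rotatedTangentFDeriv (hη : Continuous η) :
    Continuous (D.rotatedTangentFDeriv η).uncurry := by
  have h2 := D.continuous_rotationAngle hη
  have h3 : Continuous fun p : (ℝ × ℂ) × ℝ => D.rotatedTangent η p.1 p.2 :=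
    D.continuous_rotatedTangent hη
  have h4 : Continuous fun p : (ℝ × ℂ) × ℝ =>
      ContinuousLinearMap.smulRightL ℝ (ℝ × ℂ) ℂ (D.rotationAngle η p.2)
        (Complex.I * D.rotatedTangent η p.1 p.2) := by
    fun_prop
  exact h4

theorem hasFDerivAt_rotatedTangent (p : ℝ × ℂ) (t : ℝ) :
    HasFDerivAt (fun q => D.rotatedTangent η q t) (D.rotatedTangentFDeriv η p t) p := by
  have h1 : HasFDerivAt (fun q => ((D.rotationAngle η t q : ℝ) : ℂ))
      (Complex.ofRealCLM.comp (D.rotationAngle η t)) p :=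
    Complex.ofRealCLM.hasFDerivAt.comp p (D.rotationAngle η t).hasFDerivAt
  refine ((h1.const_mul Complex.I).cexp.const_mul (deriv D.curve t)).congr_fderiv ?_
  ext <;> simp [rotatedTangentFDeriv, rotatedTangent] <;> ring

theorem hasDerivAt_rotationAngle (hη : ∀ t, HasDerivAt η (ψ t) t) (p : ℝ × ℂ) (t : ℝ) :
    HasDerivAt (fun t => D.rotationAngle η t p) (D.rotationAngleDeriv ψ t p) t := by
  simp only [rotationAngle_apply, rotationAngleDeriv_apply]
  refine ((hη t).mul_const p.1).add ?_
  simpa using (D.hasDerivAt_deriv t).inner ℝ (hasDerivAt_const t p.2)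

theorem hasDerivAt_rotatedTangent (hη : ∀ t, HasDerivAt η (ψ t) t) (p : ℝ × ℂ) (t : ℝ) :
    HasDerivAt (D.rotatedTangent η p)
      (D.perturbedCurvature ψ p t * Complex.I * D.rotatedTangent η p t) t := by
  have h1 : HasDerivAt (fun t => ((D.rotationAngle η t p : ℝ) : ℂ))
      ((D.rotationAngleDeriv ψ t p : ℝ) : ℂ) t := (D.hasDerivAt_rotationAngle hη p t).ofReal_comp
  refine ((D.hasDerivAt_deriv t).mul (h1.const_mul Complex.I).cexp).congr_deriv ?_
  simp only [perturbedCurvature, rotatedTangent]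
  push_cast
  ring

theorem norm_rotatedTangent (p : ℝ × ℂ) (t : ℝ) : ‖D.rotatedTangent η p t‖ = 1 := by
  rw [rotatedTangent, norm_mul, D.unit_speed, mul_comm Complex.I, Complex.norm_exp_ofReal_mul_I,
    one_mul]

theorem hasDerivAt_perturbedCurve (hη : Continuous η) (p : ℝ × ℂ) (t : ℝ) :
    HasDerivAt (D.perturbedCurve η p) (D.rotatedTangent η p t) t := by
  have h1 : Continuous (D.rotatedTangent η p) := (D.continuous_rotatedTangent hη).uncurry_left p
  exact (h1.integral_hasStrictDerivAt 0 t).hasDerivAt.const_add _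

theorem continuous_perturbedCurve (hη : Continuous η) :
    Continuous (D.perturbedCurve η).uncurry :=
  continuous_const.add (intervalIntegral.continuous_parametric_primitive_of_continuous
    (D.continuous_rotatedTangent hη))

theorem hasFDerivAt_perturbedCurve (hη : Continuous η) (p : ℝ × ℂ) (t : ℝ) :
    HasFDerivAt (fun q => D.perturbedCurve η q t)
      (∫ τ in (0 : ℝ)..t, D.rotatedTangentFDeriv η p τ) p :=
  (hasFDerivAt_primitive (D.continuous_rotatedTangent hη) (D.continuous_rotatedTangentFDeriv hη)
    D.hasFDerivAt_rotatedTangent p 0 t).const_add _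

theorem rotatedTangent_zero : D.rotatedTangent η 0 = deriv D.curve := by
  ext t
  simp [rotatedTangent]

theorem perturbedCurve_zero : D.perturbedCurve η 0 = D.curve := by
  ext t
  rw [perturbedCurve, rotatedTangent_zero, intervalIntegral.integral_eq_sub_of_hasDerivAt
    (fun t _ => D.hasDerivAt_curve t) (D.contDiff_deriv.continuous.intervalIntegrable _ _)]
  ring

theorem rotatedTangent_periodic (hη : Function.Periodic η (2 * Real.pi)) (p : ℝ × ℂ) :
    Function.Periodic (D.rotatedTangent η p) (2 * Real.pi) := fun t => by
  simp only [rotatedTangent, rotationAngle_apply, D.deriv_periodic t, hη t]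

theorem perturbedCurve_periodic (hη : Function.Periodic η (2 * Real.pi)) (hc : Continuous η)
    {p : ℝ × ℂ} (hp : ∫ t in (0 : ℝ)..(2 * Real.pi), D.rotatedTangent η p t = 0) :
    Function.Periodic (D.perturbedCurve η p) (2 * Real.pi) := fun t => by
  have h1 : Continuous (D.rotatedTangent η p) := (D.continuous_rotatedTangent hc).uncurry_left p
  have h2 := (D.rotatedTangent_periodic hη p).intervalIntegral_add_eq t 0
  rw [zero_add, hp] at h2
  rw [perturbedCurve, perturbedCurve, ← intervalIntegral.integral_add_adjacent_intervals
    (h1.intervalIntegrable 0 t) (h1.intervalIntegrable t _), h2, add_zero]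

theorem deriv_perturbedCurve (hη : Continuous η) (p : ℝ × ℂ) :
    deriv (D.perturbedCurve η p) = D.rotatedTangent η p :=
  funext fun t => (D.hasDerivAt_perturbedCurve hη p t).deriv

theorem contDiff_perturbedCurve (hη : ∀ t, HasDerivAt η (ψ t) t) (hψ : Continuous ψ)
    (p : ℝ × ℂ) : ContDiff ℝ 2 (D.perturbedCurve η p) := by
  have hc : Continuous η := continuous_iff_continuousAt.2 fun t => (hη t).continuousAt
  have h1 : ContDiff ℝ 1 (D.rotatedTangent η p) := by
    refine contDiff_one_iff_deriv.2
      ⟨fun t => (D.hasDerivAt_rotatedTangent hη p t).differentiableAt, ?_⟩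
    rw [funext fun t => (D.hasDerivAt_rotatedTangent hη p t).deriv]
    have h2 : Continuous (D.rotatedTangent η p) := (D.continuous_rotatedTangent hc).uncurry_left p
    have h3 := D.continuous_curvature
    have h4 := D.continuous_rotationAngleDeriv hψ
    unfold perturbedCurvature
    fun_prop
  refine (contDiff_succ_iff_deriv (n := 1)).2
    ⟨fun t => (D.hasDerivAt_perturbedCurve hc p t).differentiableAt, by simp, ?_⟩
  rwa [D.deriv_perturbedCurve hc]

theorem integral_deriv_eq_zero : ∫ t in (0 : ℝ)..(2 * Real.pi), deriv D.curve t = 0 := by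
  have := D.periodic 0
  rw [zero_add] at this
  rw [intervalIntegral.integral_eq_sub_of_hasDerivAt
    (fun t _ => D.hasDerivAt_curve t) (D.contDiff_deriv.continuous.intervalIntegrable _ _),
    this, sub_self]

/-- The closing defect of the perturbed curve depends on the perturbation in a `C¹` way. -/
theorem contDiff_closingDefect (hη : Continuous η) : ContDiff ℝ 1 fun p : ℝ × ℂ =>
    ∫ t in (0 : ℝ)..(2 * Real.pi), D.rotatedTangent η p t := by
  have h := hasFDerivAt_primitive (D.continuous_rotatedTangent hη)
    (D.continuous_rotatedTangentFDeriv hη) D.hasFDerivAt_rotatedTangent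
  refine contDiff_one_iff_fderiv.2 ⟨fun p => (h p 0 _).differentiableAt, ?_⟩
  refine Continuous.congr ?_ fun p => (h p 0 (2 * Real.pi)).fderiv.symm
  exact intervalIntegral.continuous_parametric_intervalIntegral_of_continuous'
    (D.continuous_rotatedTangentFDeriv hη) _ _

theorem fderiv_closingDefect_apply (hη : Continuous η) (q : ℝ × ℂ) :
    fderiv ℝ (fun p : ℝ × ℂ => ∫ t in (0 : ℝ)..(2 * Real.pi), D.rotatedTangent η p t) 0 q =
      Complex.I *
        ∫ t in (0 : ℝ)..(2 * Real.pi), D.rotationAngle η t q • deriv D.curve t := by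
  have hsec' : Continuous (D.rotatedTangentFDeriv η 0) :=
    (D.continuous_rotatedTangentFDeriv hη).uncurry_left 0
  have h := hasFDerivAt_primitive (D.continuous_rotatedTangent hη)
    (D.continuous_rotatedTangentFDeriv hη) D.hasFDerivAt_rotatedTangent 0 0 (2 * Real.pi)
  have h2 := ContinuousLinearMap.intervalIntegral_apply (μ := MeasureTheory.volume)
    (hsec'.intervalIntegrable 0 (2 * Real.pi)) q
  rw [h.fderiv, h2, ← intervalIntegral.integral_const_mul]
  congr 1
  ext t
  simp only [rotatedTangentFDeriv, rotatedTangent_zero, ContinuousLinearMap.smulRight_apply,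
    Complex.real_smul]
  ring

/-- The Gram map of the tangent vectors is injective, because they span the plane. -/
theorem eq_zero_of_integral_inner_smul_eq_zero {w : ℂ}
    (hw : ∫ t in (0 : ℝ)..(2 * Real.pi), inner ℝ (deriv D.curve t) w • deriv D.curve t = 0) :
    w = 0 := by
  have hT := D.contDiff_deriv.continuous
  have hcont : Continuous fun t => inner ℝ (deriv D.curve t) w := by fun_prop
  refine D.eq_zero_of_inner_deriv_eq_zero (eq_zero_of_integral_sq_eq_zero hcont ?_)
  have h1 := congrArg (innerSL ℝ w) hw
  rw [← ContinuousLinearMap.intervalIntegral_comp_comm _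
    ((by fun_prop : Continuous fun t => inner ℝ (deriv D.curve t) w •
      deriv D.curve t).intervalIntegrable _ _), map_zero] at h1
  rw [← h1]
  congr 1
  ext t
  simp only [innerSL_apply_apply, inner_smul_right, real_inner_comm w]
  ring

/-- The correction `W h` can be chosen such that the perturbed curves close up. It vanishes
to first order if `η` satisfies the linearized closing condition. -/
theorem exists_closing_correction (hη : Continuous η)
    (hη0 : ∫ t in (0 : ℝ)..(2 * Real.pi), η t • deriv D.curve t = 0) :
    ∃ W : ℝ → ℂ, W 0 = 0 ∧ HasDerivAt W 0 0 ∧ ∀ᶠ h in 𝓝 (0 : ℝ), ContDiffAt ℝ 1 W h ∧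
      ∫ t in (0 : ℝ)..(2 * Real.pi), D.rotatedTangent η (h, W h) t = 0 := by
  have hΦC := D.contDiff_closingDefect hη
  have happ := D.fderiv_closingDefect_apply hη
  have hΦ0 : ∫ t in (0 : ℝ)..(2 * Real.pi), D.rotatedTangent η 0 t = 0 := by
    simp only [rotatedTangent_zero, integral_deriv_eq_zero]
  obtain ⟨Φ, hΦ⟩ : ∃ Φ : ℝ × ℂ → ℂ,
      ∀ p, Φ p = ∫ t in (0 : ℝ)..(2 * Real.pi), D.rotatedTangent η p t := ⟨_, fun _ => rfl⟩
  simp only [← hΦ] at hΦC happ hΦ0 ⊢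
  have hinj : Function.Injective (fderiv ℝ Φ 0 ∘L .inr ℝ ℝ ℂ) := by
    rw [injective_iff_map_eq_zero]
    intro w hw
    rw [ContinuousLinearMap.comp_apply, ContinuousLinearMap.inr_apply, happ, mul_eq_zero,
      or_iff_right Complex.I_ne_zero] at hw
    simp only [rotationAngle_apply, mul_zero, zero_add] at hw
    exact D.eq_zero_of_integral_inner_smul_eq_zero hw
  have hinv : (fderiv ℝ Φ (0 : ℝ × ℂ) ∘L .inr ℝ ℝ ℂ).IsInvertible :=
    ⟨(LinearEquiv.ofInjectiveEndo _ hinj).toContinuousLinearEquiv,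
      ContinuousLinearMap.ext fun _ => rfl⟩
  have hC0 : ContDiffAt ℝ 1 Φ (0 : ℝ × ℂ) := hΦC.contDiffAt
  refine ⟨hC0.implicitFunction one_ne_zero hinv, hC0.implicitFunction_apply_self one_ne_zero hinv,
    ?_, ?_⟩
  · refine (hC0.hasStrictFDerivAt_implicitFunction
      one_ne_zero hinv).hasFDerivAt.hasDerivAt.congr_deriv ?_
    have h2 : fderiv ℝ Φ (0 : ℝ × ℂ) (1, 0) = 0 := by
      rw [happ]
      simp only [rotationAngle_apply, mul_one, inner_zero_right, add_zero, hη0, mul_zero]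
    simp [h2]
  · have h1 := (hC0.contDiffAt_implicitFunction one_ne_zero hinv).eventually (by simp)
    have h2 := hC0.eventually_apply_implicitFunction one_ne_zero hinv
    filter_upwards [h1, h2] with h hh1 hh2
    exact ⟨hh1, hh2.trans hΦ0⟩

end Perturbation

end KnotDiagram

/-! ### The Euler–Lagrange equation -/

namespace KnotDiagram

variable (D : KnotDiagram)

section Perturbation

variable {η ψ : ℝ → ℝ}

/-- The derivative, in the parameter of the perturbation, of the second derivative of the
perturbed curve. -/
def perturbedSecondFDeriv (η ψ : ℝ → ℝ) (p : ℝ × ℂ) (t : ℝ) : ℝ × ℂ →L[ℝ] ℂ :=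
  (D.rotationAngleDeriv ψ t).smulRight (Complex.I * D.rotatedTangent η p t) +
    (D.perturbedCurvature ψ p t * Complex.I) • D.rotatedTangentFDeriv η p t

theorem continuous_perturbedCurvature (hψ : Continuous ψ) :
    Continuous (D.perturbedCurvature ψ).uncurry := by
  have h1 := D.continuous_curvature
  have h2 := D.continuous_rotationAngleDeriv hψ
  have h3 : Continuous fun p : (ℝ × ℂ) × ℝ => D.rotationAngleDeriv ψ p.2 p.1 :=
    (h2.comp continuous_snd).clm_apply continuous_fst
  unfold Function.uncurry perturbedCurvature
  fun_prop

theorem continuous_perturbedSecondFDeriv (hη : Continuous η) (hψ : Continuous ψ) :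
    Continuous (D.perturbedSecondFDeriv η ψ).uncurry := by
  have h1 := D.continuous_rotationAngleDeriv hψ
  have h2 : Continuous fun p : (ℝ × ℂ) × ℝ => D.perturbedCurvature ψ p.1 p.2 :=
    D.continuous_perturbedCurvature hψ
  have h3 : Continuous fun p : (ℝ × ℂ) × ℝ => D.rotatedTangent η p.1 p.2 :=
    D.continuous_rotatedTangent hη
  have h4 : Continuous fun p : (ℝ × ℂ) × ℝ => D.rotatedTangentFDeriv η p.1 p.2 :=
    D.continuous_rotatedTangentFDeriv hη
  have h5 : Continuous fun p : (ℝ × ℂ) × ℝ =>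
      ContinuousLinearMap.smulRightL ℝ (ℝ × ℂ) ℂ (D.rotationAngleDeriv ψ p.2)
        (Complex.I * D.rotatedTangent η p.1 p.2) := by
    fun_prop
  have h6 : Continuous fun p : (ℝ × ℂ) × ℝ =>
      ((D.perturbedCurvature ψ p.1 p.2 : ℂ) * Complex.I) •
        D.rotatedTangentFDeriv η p.1 p.2 := by
    fun_prop
  exact h5.add h6

theorem hasFDerivAt_perturbedCurvature (p : ℝ × ℂ) (t : ℝ) :
    HasFDerivAt (fun q => D.perturbedCurvature ψ q t) (D.rotationAngleDeriv ψ t) p :=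
  (D.rotationAngleDeriv ψ t).hasFDerivAt.const_add _

theorem hasFDerivAt_perturbedSecondDeriv (p : ℝ × ℂ) (t : ℝ) :
    HasFDerivAt (fun q => (D.perturbedCurvature ψ q t : ℂ) * Complex.I * D.rotatedTangent η q t)
      (D.perturbedSecondFDeriv η ψ p t) p := by
  have h1 : HasFDerivAt (fun q => (D.perturbedCurvature ψ q t : ℂ))
      (Complex.ofRealCLM.comp (D.rotationAngleDeriv ψ t)) p :=
    Complex.ofRealCLM.hasFDerivAt.comp p (D.hasFDerivAt_perturbedCurvature p t)
  refine ((h1.mul_const Complex.I).mul (D.hasFDerivAt_rotatedTangent p t)).congr_fderiv ?_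
  ext <;> simp [perturbedSecondFDeriv] <;> ring

/-- A jointly `C¹` family stays `C¹` along a `C¹` path `h ↦ (h, W h)` of parameters. -/
theorem exists_continuousOn_hasDerivAt_along {f : ℝ × ℂ → ℝ → ℂ}
    {f' : ℝ × ℂ → ℝ → ℝ × ℂ →L[ℝ] ℂ} (hf' : Continuous f'.uncurry)
    (hd : ∀ p t, HasFDerivAt (fun q => f q t) (f' p t) p) {W : ℝ → ℂ} {ε : ℝ}
    (hW : ∀ h ∈ Ioo (-ε) ε, ContDiffAt ℝ 1 W h) :
    ∃ V : ℝ × ℝ → ℂ, ContinuousOn V (Ioo (-ε) ε ×ˢ univ) ∧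
      ∀ h ∈ Ioo (-ε) ε, ∀ t, HasDerivAt (fun h' => f (h', W h') t) (V (h, t)) h := by
  have hW1 : ContDiffOn ℝ 1 W (Ioo (-ε) ε) := fun h hh => (hW h hh).contDiffWithinAt
  have hfst : MapsTo (Prod.fst : ℝ × ℝ → ℝ) (Ioo (-ε) ε ×ˢ univ) (Ioo (-ε) ε) :=
    fun p hp => hp.1
  have hc1 : ContinuousOn (fun p : ℝ × ℝ => W p.1) (Ioo (-ε) ε ×ˢ univ) :=
    hW1.continuousOn.comp continuousOn_fst hfst
  have hc2 : ContinuousOn (fun p : ℝ × ℝ => deriv W p.1) (Ioo (-ε) ε ×ˢ univ) :=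
    (hW1.continuousOn_deriv_of_isOpen isOpen_Ioo le_rfl).comp continuousOn_fst hfst
  refine ⟨fun p => f' (p.1, W p.1) p.2 (1, deriv W p.1), ?_, fun h hh t => ?_⟩
  · have h1 : ContinuousOn (fun p : ℝ × ℝ => f' (p.1, W p.1) p.2) (Ioo (-ε) ε ×ˢ univ) :=
      hf'.comp_continuousOn ((continuousOn_fst.prodMk hc1).prodMk continuousOn_snd)
    exact h1.clm_apply (continuousOn_const.prodMk hc2)
  · have h1 : HasDerivAt (fun h => (h, W h)) (1, deriv W h) h :=
      (hasDerivAt_id h).prodMk ((hW h hh).differentiableAt one_ne_zero).hasDerivAt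
    exact (hd (h, W h) t).comp_hasDerivAt h h1

theorem iteratedDeriv_two_perturbedCurve (hη : ∀ t, HasDerivAt η (ψ t) t) (p : ℝ × ℂ) (t : ℝ) :
    iteratedDeriv 2 (D.perturbedCurve η p) t =
      D.perturbedCurvature ψ p t * Complex.I * D.rotatedTangent η p t := by
  have hc : Continuous η := continuous_iff_continuousAt.2 fun t => (hη t).continuousAt
  rw [iteratedDeriv_succ, iteratedDeriv_one, D.deriv_perturbedCurve hc,
    (D.hasDerivAt_rotatedTangent hη p t).deriv]

/-- A formula for the `j`-th derivative of a family of curves in terms of `(h, w)` yields the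
differentiability of that derivative along a path of parameters. -/
theorem lift_iteratedDeriv (j : ℕ) {f : ℝ × ℂ → ℝ → ℂ} {f' : ℝ × ℂ → ℝ → ℝ × ℂ →L[ℝ] ℂ}
    {c : ℝ × ℂ → ℝ → ℂ} (hf' : Continuous f'.uncurry)
    (hd : ∀ p t, HasFDerivAt (fun q => f q t) (f' p t) p)
    (hj : ∀ p t, iteratedDeriv j (c p) t = f p t) {W : ℝ → ℂ} {ε : ℝ}
    (hW : ∀ h ∈ Ioo (-ε) ε, ContDiffAt ℝ 1 W h) {F : ℝ → KnotDiagram}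
    (hF : ∀ h ∈ Ioo (-ε) ε, (F h).curve = c (h, W h)) :
    ∃ V : ℝ × ℝ → ℂ, ContinuousOn V (Ioo (-ε) ε ×ˢ univ) ∧ ∀ h ∈ Ioo (-ε) ε, ∀ t : ℝ,
      HasDerivAt (fun h' : ℝ => iteratedDeriv j (F h').curve t) (V (h, t)) h := by
  obtain ⟨V, hV, hVd⟩ := exists_continuousOn_hasDerivAt_along hf' hd hW
  refine ⟨V, hV, fun h hh t => (hVd h hh t).congr_of_eventuallyEq ?_⟩
  filter_upwards [Ioo_mem_nhds hh.1 hh.2] with h' hh'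
  rw [hF h' hh', hj]

/-- First variation of the total squared curvature along a path of perturbed curves whose closing
correction vanishes to first order. -/
theorem hasDerivAt_uniformization (hη : ∀ t, HasDerivAt η (ψ t) t) (hψ : Continuous ψ)
    {W : ℝ → ℂ} (hW0 : W 0 = 0) (hW'0 : HasDerivAt W 0 0) {F : ℝ → KnotDiagram}
    (hF : ∀ᶠ h in 𝓝 (0 : ℝ), (F h).curve = D.perturbedCurve η (h, W h)) :
    HasDerivAt (fun h => (F h).uniformization fun x => x ^ 2)
      (2 * ∫ t in (0 : ℝ)..(2 * Real.pi), D.curvature t * ψ t) 0 := by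
  have hc : Continuous η := continuous_iff_continuousAt.2 fun t => (hη t).continuousAt
  have hcurv : ∀ h, (F h).curve = D.perturbedCurve η (h, W h) →
      ∀ t, (F h).curvature t = D.perturbedCurvature ψ (h, W h) t := by
    intro h hh t
    have h1 := D.norm_rotatedTangent (η := η) (h, W h) t
    rw [curvature, hh, D.deriv_perturbedCurve hc,
      (D.hasDerivAt_rotatedTangent hη _ t).deriv, mul_left_comm,
      ← Complex.normSq_eq_conj_mul_self, Complex.normSq_eq_norm_sq, h1]
    simp
  have hκ := D.continuous_perturbedCurvature hψ
  have hκ2 : Continuous fun z : (ℝ × ℂ) × ℝ => D.perturbedCurvature ψ z.1 z.2 := hκ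
  have hL : Continuous fun z : (ℝ × ℂ) × ℝ => D.rotationAngleDeriv ψ z.2 :=
    (D.continuous_rotationAngleDeriv hψ).comp continuous_snd
  have h1 := hasFDerivAt_primitive (f := fun p t => D.perturbedCurvature ψ p t ^ 2)
    (f' := fun p t => (2 * D.perturbedCurvature ψ p t) • D.rotationAngleDeriv ψ t)
    ((continuous_pow 2).comp hκ2) ((continuous_const.mul hκ2).smul hL)
    (fun p t => by simpa using (D.hasFDerivAt_perturbedCurvature p t).pow 2)
    ((0 : ℝ), W 0) 0 (2 * Real.pi)
  have h2 : HasDerivAt (fun h => (h, W h)) ((1 : ℝ), (0 : ℂ)) 0 := (hasDerivAt_id 0).prodMk hW'0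
  have h3 := (h1.comp_hasDerivAt (0 : ℝ) h2).congr_of_eventuallyEq
    (f₁ := fun h => (F h).uniformization fun x => x ^ 2) (by
      filter_upwards [hF] with h hh
      simp only [uniformization, Function.comp, hcurv h hh])
  refine h3.congr_deriv ?_
  have hcont : Continuous fun t => (2 * D.perturbedCurvature ψ ((0 : ℝ), W 0) t) •
      D.rotationAngleDeriv ψ t :=
    (continuous_const.mul (hκ.uncurry_left _)).smul (D.continuous_rotationAngleDeriv hψ)
  rw [ContinuousLinearMap.intervalIntegral_apply (μ := MeasureTheory.volume)
    (hcont.intervalIntegrable 0 (2 * Real.pi)), ← intervalIntegral.integral_const_mul]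
  congr 1
  ext t
  simp [perturbedCurvature, rotationAngleDeriv_apply, hW0]
  ring

/-- Small perturbed curves that close up are knot diagrams. -/
theorem exists_perturbed_family (hη : ∀ t, HasDerivAt η (ψ t) t) (hψ : Continuous ψ)
    (hper : Function.Periodic η (2 * Real.pi)) {W : ℝ → ℂ} (hW0 : W 0 = 0)
    (hWc : ContinuousAt W 0)
    (hW : ∀ᶠ h in 𝓝 (0 : ℝ),
      ∫ t in (0 : ℝ)..(2 * Real.pi), D.rotatedTangent η (h, W h) t = 0) :
    ∃ F : ℝ → KnotDiagram, F 0 = D ∧ ∃ ε > 0,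
      (∀ h ∈ Ioo (-ε) ε, (F h).curve = D.perturbedCurve η (h, W h)) ∧
      ∀ h ∈ Ioo (-ε) ε, ∀ t : ℝ, (F h).IsCrossing t →
        ∀ᶠ p : ℝ × ℝ in 𝓝 (h, t), (F p.1).IsCrossing p.2 →
          (p.2 ∈ (F p.1).upper ↔ t ∈ (F h).upper) := by
  have hc : Continuous η := continuous_iff_continuousAt.2 fun t => (hη t).continuousAt
  have hpath : ∀ t, ContinuousAt (fun p : ℝ × ℝ => (((p.1, W p.1) : ℝ × ℂ), p.2)) (0, t) :=
    fun t => by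
      have h1 : ContinuousAt (fun p : ℝ × ℝ => W p.1) (0, t) :=
        ContinuousAt.comp' (f := Prod.fst) (g := W) hWc continuousAt_fst
      exact (continuousAt_fst.prodMk h1).prodMk continuousAt_snd
  obtain ⟨G, hG⟩ : ∃ G : ℝ → ℝ → ℂ, ∀ h, G h = D.perturbedCurve η (h, W h) := ⟨_, fun _ => rfl⟩
  have hG' : ∀ h, deriv (G h) = D.rotatedTangent η (h, W h) := fun h => by
    rw [hG, D.deriv_perturbedCurve hc]
  have h0 : G 0 = D.curve := by
    rw [hG, hW0]
    exact D.perturbedCurve_zero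
  have h1 : ∀ᶠ h in 𝓝 (0 : ℝ), ContDiff ℝ 2 (G h) := Eventually.of_forall fun h => by
    rw [hG]
    exact D.contDiff_perturbedCurve hη hψ _
  have h2 : ∀ᶠ h in 𝓝 (0 : ℝ), Function.Periodic (G h) (2 * Real.pi) := hW.mono fun h hh => by
    rw [hG]
    exact D.perturbedCurve_periodic hper hc hh
  have h3 : ∀ᶠ h in 𝓝 (0 : ℝ), ∀ t, ‖deriv (G h) t‖ = 1 := Eventually.of_forall fun h t => by
    rw [hG']
    exact D.norm_rotatedTangent _ t
  have h4 : ∀ t, ContinuousAt (fun p : ℝ × ℝ => G p.1 p.2) (0, t) := fun t => by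
    simp only [hG]
    have h6 : Continuous fun z : (ℝ × ℂ) × ℝ => D.perturbedCurve η z.1 z.2 :=
      D.continuous_perturbedCurve hc
    exact ContinuousAt.comp' (f := fun p : ℝ × ℝ => (((p.1, W p.1) : ℝ × ℂ), p.2))
      (g := fun z : (ℝ × ℂ) × ℝ => D.perturbedCurve η z.1 z.2) h6.continuousAt (hpath t)
  have h5 : ∀ t, ContinuousAt (fun p : ℝ × ℝ => deriv (G p.1) p.2) (0, t) := fun t => by
    simp only [hG']
    have h6 : Continuous fun z : (ℝ × ℂ) × ℝ => D.rotatedTangent η z.1 z.2 :=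
      D.continuous_rotatedTangent hc
    exact ContinuousAt.comp' (f := fun p : ℝ × ℝ => (((p.1, W p.1) : ℝ × ℂ), p.2))
      (g := fun z : (ℝ × ℂ) × ℝ => D.rotatedTangent η z.1 z.2) h6.continuousAt (hpath t)
  simpa only [hG] using D.exists_family G h0 h1 h2 h3 h4 h5

/-- Every infinitesimal rotation `η` of the tangent vectors which satisfies the linearized
closing condition is realized by a variation, and the total squared curvature has the expected
derivative along it. -/
theorem exists_variation (hη : ∀ t, HasDerivAt η (ψ t) t) (hψ : Continuous ψ)
    (hper : Function.Periodic η (2 * Real.pi))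
    (hη0 : ∫ t in (0 : ℝ)..(2 * Real.pi), η t • deriv D.curve t = 0) :
    ∃ F : ℝ → KnotDiagram, D.IsVariation F ∧
      HasDerivAt (fun h => (F h).uniformization fun x => x ^ 2)
        (2 * ∫ t in (0 : ℝ)..(2 * Real.pi), D.curvature t * ψ t) 0 := by
  have hc : Continuous η := continuous_iff_continuousAt.2 fun t => (hη t).continuousAt
  obtain ⟨W, hW0, hW'0, hW⟩ := D.exists_closing_correction hc hη0
  obtain ⟨F, hF0, ε₁, hε₁, hFc, hFu⟩ := D.exists_perturbed_family hη hψ hper hW0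
    hW'0.continuousAt (hW.mono fun h hh => hh.2)
  obtain ⟨ε₂, hε₂, hWε⟩ := Metric.eventually_nhds_iff.1 hW
  set ε := min ε₁ ε₂ with hε
  have hεpos : 0 < ε := lt_min hε₁ hε₂
  have hsub : ∀ h ∈ Ioo (-ε) ε, h ∈ Ioo (-ε₁) ε₁ := fun h hh =>
    ⟨by linarith [hh.1, min_le_left ε₁ ε₂], by linarith [hh.2, min_le_left ε₁ ε₂]⟩
  have hWC : ∀ h ∈ Ioo (-ε) ε, ContDiffAt ℝ 1 W h := fun h hh => (hWε (y := h) (by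
    rw [dist_zero_right, Real.norm_eq_abs]
    exact (abs_lt.2 hh).trans_le (min_le_right _ _))).1
  replace hFc := fun h hh => hFc h (hsub h hh)
  refine ⟨F, ⟨hF0, ε, hεpos, fun j hj => ?_, fun h hh => hFu h (hsub h hh)⟩, ?_⟩
  · interval_cases j
    · exact lift_iteratedDeriv 0
        (f' := fun p t => ∫ τ in (0 : ℝ)..t, D.rotatedTangentFDeriv η p τ)
        (intervalIntegral.continuous_parametric_primitive_of_continuous
        (D.continuous_rotatedTangentFDeriv hc)) (D.hasFDerivAt_perturbedCurve hc)
        (fun p t => by rw [iteratedDeriv_zero]) hWC hFc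
    · exact lift_iteratedDeriv 1 (D.continuous_rotatedTangentFDeriv hc) D.hasFDerivAt_rotatedTangent
        (fun p t => by rw [iteratedDeriv_one, D.deriv_perturbedCurve hc]) hWC hFc
    · exact lift_iteratedDeriv 2 (D.continuous_perturbedSecondFDeriv hc hψ)
        D.hasFDerivAt_perturbedSecondDeriv (D.iteratedDeriv_two_perturbedCurve hη) hWC hFc
  · refine D.hasDerivAt_uniformization hη hψ hW0 hW'0 ?_
    filter_upwards [Ioo_mem_nhds (neg_lt_zero.2 hεpos) hεpos] with h hh using hFc h hh

end Perturbation

/-- A diagram without small alternated cycles that is critical for the total energy is critical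
for the total squared curvature: the former energy dominates the latter, with equality
at the diagram. -/
theorem hasDerivAt_uniformization_eq_zero {D : KnotDiagram} {δ : ℝ}
    (hD : D.IsCritical (totalEnergy δ))
    (hcyc : ∀ C : Set ℂ, D.IsAlternated C → ¬ cycleArea C < ENNReal.ofReal δ)
    {F : ℝ → KnotDiagram} (hF : D.IsVariation F) {u : ℝ}
    (hu : HasDerivAt (fun h => (F h).uniformization fun x => x ^ 2) u 0) : u = 0 := by
  obtain ⟨hfin, hE⟩ := hD F hF
  have hU : ∀ h, 0 ≤ (F h).uniformization fun x => x ^ 2 := fun h =>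
    intervalIntegral.integral_nonneg Real.two_pi_pos.le fun t _ => sq_nonneg _
  have hmre : D.mre δ = 0 := by
    have : IsEmpty {C : Set ℂ // D.IsAlternated C ∧ cycleArea C < ENNReal.ofReal δ} :=
      ⟨fun C => hcyc C.1 C.2.1 C.2.2⟩
    rw [mre, tsum_empty]
  have hmin : IsLocalMin (fun h => (totalEnergy δ (F h)).toReal -
      (F h).uniformization fun x => x ^ 2) 0 := by
    filter_upwards [hfin] with h hh
    have h0 : (totalEnergy δ (F 0)).toReal - (F 0).uniformization (fun x => x ^ 2) = 0 := by
      rw [totalEnergy, hF.1, hmre, zero_add, ENNReal.toReal_ofReal, sub_self]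
      have := hU 0
      rwa [hF.1] at this
    rw [h0, sub_nonneg]
    calc (F h).uniformization (fun x => x ^ 2)
        = (ENNReal.ofReal ((F h).uniformization fun x => x ^ 2)).toReal :=
          (ENNReal.toReal_ofReal (hU h)).symm
      _ ≤ _ := ENNReal.toReal_mono hh (by rw [totalEnergy]; exact le_add_self)
  have := hmin.hasDerivAt_eq_zero (hE.sub hu)
  linarith

/-- The affine functions `t ↦ c + ⟪P, γ t⟫` of position contain the `L²`-orthogonal projection of
every continuous function. -/
theorem exists_affine_projection {f : ℝ → ℝ} (hf : Continuous f) :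
    ∃ (c : ℝ) (P : ℂ),
      ∫ t in (0 : ℝ)..(2 * Real.pi), (f t - (c + inner ℝ (D.curve t) P)) = 0 ∧
      ∫ t in (0 : ℝ)..(2 * Real.pi), (f t - (c + inner ℝ (D.curve t) P)) • D.curve t = 0 := by
  have hγ : Continuous D.curve := D.contDiff.continuous
  have hc1 : ∀ q : ℝ × ℂ, IntervalIntegrable (fun t => q.1 + inner ℝ (D.curve t) q.2)
      MeasureTheory.volume 0 (2 * Real.pi) := fun q =>
    (by fun_prop : Continuous fun t => q.1 + inner ℝ (D.curve t) q.2).intervalIntegrable _ _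
  have hc2 : ∀ q : ℝ × ℂ, IntervalIntegrable
      (fun t => (q.1 + inner ℝ (D.curve t) q.2) • D.curve t)
      MeasureTheory.volume 0 (2 * Real.pi) := fun q =>
    (by fun_prop : Continuous fun t =>
      (q.1 + inner ℝ (D.curve t) q.2) • D.curve t).intervalIntegrable _ _
  let M : ℝ × ℂ →ₗ[ℝ] ℝ × ℂ :=
    { toFun := fun q => (∫ t in (0 : ℝ)..(2 * Real.pi), (q.1 + inner ℝ (D.curve t) q.2),
        ∫ t in (0 : ℝ)..(2 * Real.pi), (q.1 + inner ℝ (D.curve t) q.2) • D.curve t)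
      map_add' := fun p q => by
        refine Prod.ext ?_ ?_
        · refine Eq.trans ?_ (intervalIntegral.integral_add (hc1 p) (hc1 q))
          simp only [Prod.fst_add, Prod.snd_add, inner_add_right, add_add_add_comm]
        · refine Eq.trans ?_ (intervalIntegral.integral_add (hc2 p) (hc2 q))
          simp only [Prod.fst_add, Prod.snd_add, inner_add_right, ← add_smul, add_add_add_comm]
      map_smul' := fun r p => by
        refine Prod.ext ?_ ?_
        · refine Eq.trans ?_ (intervalIntegral.integral_smul r _)
          simp only [Prod.smul_fst, Prod.smul_snd, inner_smul_right, smul_eq_mul, mul_add]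
        · refine Eq.trans ?_ (intervalIntegral.integral_smul r _)
          simp only [Prod.smul_fst, Prod.smul_snd, inner_smul_right, smul_smul, smul_eq_mul,
            mul_add] }
  have hM : ∀ q, M q = (∫ t in (0 : ℝ)..(2 * Real.pi), (q.1 + inner ℝ (D.curve t) q.2),
        ∫ t in (0 : ℝ)..(2 * Real.pi), (q.1 + inner ℝ (D.curve t) q.2) • D.curve t) :=
    fun q => rfl
  have hinj : Function.Injective M := by
    rw [injective_iff_map_eq_zero]
    rintro ⟨c, P⟩ hq
    rw [hM, Prod.mk_eq_zero] at hq
    obtain ⟨h1, h2⟩ := hq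
    set g : ℝ → ℝ := fun t => c + inner ℝ (D.curve t) P with hg
    have hgc : Continuous g := by fun_prop
    have h3 : ∫ t in (0 : ℝ)..(2 * Real.pi), g t ^ 2 = 0 := by
      have h4 := congrArg (innerSL ℝ P) h2
      rw [← ContinuousLinearMap.intervalIntegral_comp_comm _
        ((by fun_prop : Continuous _).intervalIntegrable _ _), map_zero] at h4
      have h5 := intervalIntegral.integral_add (μ := MeasureTheory.volume)
        ((by fun_prop : Continuous fun t => c * g t).intervalIntegrable 0 (2 * Real.pi))
        ((by fun_prop : Continuous fun t =>
          (innerSL ℝ P) (g t • D.curve t)).intervalIntegrable 0 (2 * Real.pi))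
      rw [intervalIntegral.integral_const_mul, h1, h4, mul_zero, add_zero] at h5
      rw [← h5]
      congr 1
      ext t
      simp only [innerSL_apply_apply, inner_smul_right, real_inner_comm (D.curve t), hg]
      ring
    have h4 : ∀ t, g t = 0 := Function.Periodic.eq_zero_of_Icc
      (fun t => by simp only [hg, D.periodic t]) (eq_zero_of_integral_sq_eq_zero hgc h3)
    have h5 : P = 0 := D.eq_zero_of_inner_deriv_eq_zero fun t _ => by
      have h6 : HasDerivAt g (inner ℝ (deriv D.curve t) P) t := by
        refine (((D.hasDerivAt_curve t).inner ℝ (hasDerivAt_const t P)).const_add c).congr_deriv ?_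
        rw [inner_zero_right, zero_add]
      rw [funext h4] at h6
      exact h6.unique (hasDerivAt_const t 0)
    have h6 := h4 0
    simp only [hg, h5, inner_zero_right, add_zero] at h6
    rw [h5, h6]
    rfl
  obtain ⟨⟨c, P⟩, hq⟩ := (LinearMap.injective_iff_surjective.1 hinj)
    (∫ t in (0 : ℝ)..(2 * Real.pi), f t, ∫ t in (0 : ℝ)..(2 * Real.pi), f t • D.curve t)
  rw [hM, Prod.mk.injEq] at hq
  refine ⟨c, P, ?_, ?_⟩
  · rw [intervalIntegral.integral_sub (hf.intervalIntegrable _ _)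
      ((by fun_prop : Continuous _).intervalIntegrable _ _), hq.1, sub_self]
  · simp only [sub_smul]
    rw [intervalIntegral.integral_sub ((by fun_prop : Continuous _).intervalIntegrable _ _)
      ((by fun_prop : Continuous _).intervalIntegrable _ _), hq.2, sub_self]

/-- Euler–Lagrange equation: the curvature of a critical diagram without small alternated
cycles is an affine function of position. -/
theorem exists_curvature_eq_affine {D : KnotDiagram} {δ : ℝ}
    (hD : D.IsCritical (totalEnergy δ))
    (hcyc : ∀ C : Set ℂ, D.IsAlternated C → ¬ cycleArea C < ENNReal.ofReal δ) :
    ∃ (c : ℝ) (P : ℂ), ∀ t, D.curvature t = c + inner ℝ (D.curve t) P := by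
  have hγ : Continuous D.curve := D.contDiff.continuous
  have hκ := D.continuous_curvature
  obtain ⟨c, P, h1, h2⟩ := D.exists_affine_projection hκ
  refine ⟨c, P, ?_⟩
  set ψ : ℝ → ℝ := fun t => D.curvature t - (c + inner ℝ (D.curve t) P) with hψ
  have hψc : Continuous ψ := by fun_prop
  have hψp : Function.Periodic ψ (2 * Real.pi) := fun t => by
    simp only [hψ, D.curvature_periodic t, D.periodic t]
  -- The test direction is the primitive of the error `ψ` of the projection.
  set η : ℝ → ℝ := fun t => ∫ τ in (0 : ℝ)..t, ψ τ with hη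
  have hηd : ∀ t, HasDerivAt η (ψ t) t := fun t => (hψc.integral_hasStrictDerivAt 0 t).hasDerivAt
  have hηp : Function.Periodic η (2 * Real.pi) := fun t => by
    have h3 := hψp.intervalIntegral_add_eq t 0
    rw [zero_add, h1] at h3
    simp only [hη]
    rw [← intervalIntegral.integral_add_adjacent_intervals
      (hψc.intervalIntegrable 0 t) (hψc.intervalIntegrable t _), h3, add_zero]
  have hη0 : ∫ t in (0 : ℝ)..(2 * Real.pi), η t • deriv D.curve t = 0 := by
    have hT := D.contDiff_deriv.continuous
    have hηc : Continuous η := continuous_iff_continuousAt.2 fun t => (hηd t).continuousAt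
    have h3 := intervalIntegral.integral_eq_sub_of_hasDerivAt (a := 0) (b := 2 * Real.pi)
      (fun t _ => (hηd t).smul (D.hasDerivAt_curve t))
      ((by fun_prop : Continuous _).intervalIntegrable _ _)
    rw [intervalIntegral.integral_add ((by fun_prop : Continuous _).intervalIntegrable _ _)
      ((by fun_prop : Continuous _).intervalIntegrable _ _), h2, add_zero] at h3
    have h4 := hηp 0
    have h5 := D.periodic 0
    rw [zero_add] at h4 h5
    rw [h3]
    simp [h4, h5]
  obtain ⟨F, hF, hFd⟩ := D.exists_variation hηd hψc hηp hη0
  have h3 := hasDerivAt_uniformization_eq_zero hD hcyc hF hFd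
  have h4 : ∫ t in (0 : ℝ)..(2 * Real.pi), ψ t ^ 2 = 0 := by
    have h5 := congrArg (innerSL ℝ P) h2
    rw [← ContinuousLinearMap.intervalIntegral_comp_comm _
      ((by fun_prop : Continuous _).intervalIntegrable _ _), map_zero] at h5
    have h6 : ∀ t, ψ t ^ 2 = D.curvature t * ψ t - c * ψ t - (innerSL ℝ P) (ψ t • D.curve t) :=
      fun t => by
        simp only [innerSL_apply_apply, inner_smul_right, real_inner_comm (D.curve t), hψ]
        ring
    simp only [h6]
    rw [intervalIntegral.integral_sub ((by fun_prop : Continuous _).intervalIntegrable _ _)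
      ((by fun_prop : Continuous _).intervalIntegrable _ _), h5, intervalIntegral.integral_sub
      ((by fun_prop : Continuous _).intervalIntegrable _ _)
      ((by fun_prop : Continuous _).intervalIntegrable _ _), intervalIntegral.integral_const_mul,
      h1]
    linarith
  intro t
  exact sub_eq_zero.1 (hψp.eq_zero_of_Icc (eq_zero_of_integral_sq_eq_zero hψc h4) t)

end KnotDiagram

/-! ### Multiple coverings, tangent angles and circles -/

namespace KnotDiagram

variable (D : KnotDiagram)

/-- A knot diagram is not a multiple covering of a closed curve, as its double points are
isolated. -/
theorem not_periodic {T : ℝ} (h0 : 0 < T) (h1 : T < 2 * Real.pi) :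
    ¬ Function.Periodic D.curve T := by
  intro hT
  have hcr : ∀ s, D.IsCrossing s := fun s => by
    refine ⟨s + T, (hT s).symm, fun n hn => ?_⟩
    have hn' : T = n * (2 * Real.pi) := by linarith
    have hpi := Real.pi_pos
    rcases le_or_gt n 0 with hn0 | hn0
    · have : (n : ℝ) ≤ 0 := by exact_mod_cast hn0
      nlinarith
    · have : (1 : ℝ) ≤ n := by exact_mod_cast hn0
      nlinarith
  obtain ⟨r, hr, hsep⟩ := D.exists_crossing_separation
  have := hsep 0 r (hcr 0) (hcr r) (by rw [zero_sub, abs_neg, abs_of_pos hr]; linarith)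
  linarith

/-- If the velocity has a period `2π / m`, then so has the curve, and hence `m = 1`. -/
theorem eq_one_of_deriv_periodic {m : ℕ} (hm : 0 < m)
    (h : Function.Periodic (deriv D.curve) (2 * Real.pi / m)) : m = 1 := by
  set T := 2 * Real.pi / m with hT
  have hm' : (0 : ℝ) < m := by exact_mod_cast hm
  have hpi := Real.two_pi_pos
  have hd : ∀ t, HasDerivAt (fun t => D.curve (t + T) - D.curve t) 0 t := fun t => by
    have := ((D.hasDerivAt_curve (t + T)).comp_add_const t T).sub (D.hasDerivAt_curve t)
    rwa [h t, sub_self] at this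
  have hconst : ∀ t, D.curve (t + T) = D.curve t + (D.curve T - D.curve 0) := fun t => by
    have := is_const_of_deriv_eq_zero (fun t => (hd t).differentiableAt)
      (fun t => (hd t).deriv) t 0
    rw [zero_add] at this
    rw [← this]
    ring
  have hmul : ∀ n : ℕ, D.curve (n * T) = D.curve 0 + n * (D.curve T - D.curve 0) := fun n => by
    induction n with
    | zero => simp
    | succ n ih =>
      push_cast
      rw [add_mul, one_mul, hconst, ih]
      ring
  have hv : D.curve T - D.curve 0 = 0 := by
    have h1 := hmul m
    have h2 := D.periodic 0
    rw [zero_add] at h2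
    rw [hT, mul_div_cancel₀ _ hm'.ne', ← hT, h2, left_eq_add, mul_eq_zero] at h1
    exact h1.resolve_left (by exact_mod_cast hm.ne')
  by_contra hne
  have h2 : (2 : ℝ) ≤ m := by exact_mod_cast (by omega : 2 ≤ m)
  refine D.not_periodic (T := T) (by positivity) ?_ fun t => by rw [hconst, hv, add_zero]
  rw [hT, div_lt_iff₀ hm']
  nlinarith

theorem exists_curvature_ne_zero : ∃ t, D.curvature t ≠ 0 := by
  by_contra! h
  have hconst : ∀ t, deriv D.curve t = deriv D.curve 0 := fun t => by
    refine is_const_of_deriv_eq_zero (fun t => (D.hasDerivAt_deriv t).differentiableAt)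
      (fun t => ?_) t 0
    rw [(D.hasDerivAt_deriv t).deriv, h t]
    simp
  have h0 := D.integral_deriv_eq_zero
  simp only [hconst, intervalIntegral.integral_const, sub_zero, smul_eq_zero] at h0
  exact h0.elim Real.two_pi_pos.ne' (D.deriv_ne_zero 0)

/-- The tangent vector has a continuous angle whose derivative is the curvature. -/
theorem exists_tangent_angle {u : ℂ} {t₀ α₀ : ℝ}
    (h0 : deriv D.curve t₀ = u * Complex.exp (α₀ * Complex.I)) :
    ∃ α : ℝ → ℝ, α t₀ = α₀ ∧ (∀ t, HasDerivAt α (D.curvature t) t) ∧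
      ∀ t, deriv D.curve t = u * Complex.exp (α t * Complex.I) := by
  set α : ℝ → ℝ := fun t => α₀ + ∫ τ in t₀..t, D.curvature τ with hα
  have hα0 : α t₀ = α₀ := by simp [hα]
  have hαd : ∀ t, HasDerivAt α (D.curvature t) t := fun t =>
    (D.continuous_curvature.integral_hasStrictDerivAt t₀ t).hasDerivAt.const_add _
  refine ⟨α, hα0, hαd, fun t => ?_⟩
  have hd : ∀ t, HasDerivAt (fun t => deriv D.curve t * Complex.exp (-(α t * Complex.I))) 0 t :=
    fun t => by
      have h1 : HasDerivAt (fun t => (α t : ℂ)) (D.curvature t : ℂ) t := (hαd t).ofReal_comp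
      refine ((D.hasDerivAt_deriv t).mul (h1.mul_const Complex.I).neg.cexp).congr_deriv ?_
      ring
  have h1 := is_const_of_deriv_eq_zero (fun t => (hd t).differentiableAt)
    (fun t => (hd t).deriv) t t₀
  simp only [hα0] at h1
  rw [h0, mul_assoc, ← Complex.exp_add, add_neg_cancel, Complex.exp_zero, mul_one] at h1
  rw [← h1, mul_assoc, ← Complex.exp_add, neg_add_cancel, Complex.exp_zero, mul_one]

/-- Diagrams of constant curvature are circles passed once. -/
theorem isCirclePassedOnce_of_curvature_eq {c : ℝ} (hc : ∀ t, D.curvature t = c) :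
    D.IsCirclePassedOnce := by
  have hc0 : c ≠ 0 := by
    obtain ⟨t, ht⟩ := D.exists_curvature_ne_zero
    rwa [hc t] at ht
  have hcI : (c : ℂ) * Complex.I ≠ 0 :=
    mul_ne_zero (by exact_mod_cast hc0) Complex.I_ne_zero
  set v := deriv D.curve 0 with hv
  have hv0 : v ≠ 0 := D.deriv_ne_zero 0
  have htan : ∀ t, deriv D.curve t = v * Complex.exp ((c * t : ℝ) * Complex.I) := fun t => by
    obtain ⟨α, hα0, hαd, hα⟩ := D.exists_tangent_angle (u := v) (t₀ := 0) (α₀ := 0) (by simp [hv])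
    have hd : ∀ t, HasDerivAt (fun t => α t - c * t) 0 t := fun t => by
      refine ((hαd t).sub ((hasDerivAt_id t).const_mul c)).congr_deriv ?_
      simp [hc]
    have := is_const_of_deriv_eq_zero (fun t => (hd t).differentiableAt)
      (fun t => (hd t).deriv) t 0
    rw [hα t, show α t = c * t by simpa [hα0, sub_eq_zero] using this]
  have hcurve : ∀ t, D.curve t = (D.curve 0 - v / (c * Complex.I)) +
      v * Complex.exp ((c * t : ℝ) * Complex.I) / (c * Complex.I) := fun t => by
    have hd : ∀ t, HasDerivAt (fun t => D.curve t - deriv D.curve t / (c * Complex.I)) 0 t :=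
      fun t => by
        refine ((D.hasDerivAt_curve t).sub ((D.hasDerivAt_deriv t).div_const _)).congr_deriv ?_
        rw [hc, mul_div_cancel_left₀ _ hcI, sub_self]
    have := is_const_of_deriv_eq_zero (fun t => (hd t).differentiableAt)
      (fun t => (hd t).deriv) t 0
    rw [← htan, hv, ← this]
    ring
  -- The turning number is an integer `n`, and `|n| = 1` because the diagram is covered once.
  obtain ⟨n, hn⟩ : ∃ n : ℤ, c = n := by
    have h1 := htan (0 + 2 * Real.pi)
    rw [D.deriv_periodic 0, ← hv, left_eq_mul₀ hv0, Complex.exp_eq_one_iff] at h1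
    obtain ⟨n, hn⟩ := h1
    refine ⟨n, ?_⟩
    have h2 := congrArg Complex.im hn
    simp at h2
    exact h2
  have habs : |c| = 1 := by
    have hpos : 0 < n.natAbs := Int.natAbs_pos.2 (by rintro rfl; exact hc0 (by simpa using hn))
    have habs' : ((n.natAbs : ℕ) : ℝ) = |c| := by rw [hn, Nat.cast_natAbs, Int.cast_abs]
    rw [← habs']
    have h1 := D.eq_one_of_deriv_periodic hpos fun t => by
      rw [htan, htan, habs']
      congr 1
      rcases abs_choice c with h | h <;> rw [h]
      · rw [show ((c * (t + 2 * Real.pi / c) : ℝ) : ℂ) * Complex.I =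
            (c * t : ℝ) * Complex.I + 2 * Real.pi * Complex.I by
          rw [mul_add, mul_div_cancel₀ _ hc0]; push_cast; ring, Complex.exp_periodic]
      · rw [show ((c * t : ℝ) : ℂ) * Complex.I = (c * (t + 2 * Real.pi / -c) : ℝ) * Complex.I +
            2 * Real.pi * Complex.I by
          rw [mul_add, div_neg, mul_neg, mul_div_cancel₀ _ hc0]; push_cast; ring,
          Complex.exp_periodic]
    exact_mod_cast h1
  have hcc : c * c = 1 := by rw [← abs_mul_abs_self, habs, one_mul]
  have hnorm : ‖(c : ℂ) * Complex.I‖ = 1 := by simp [habs]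
  refine ⟨⟨D.curve 0 - v / (c * Complex.I), 1, one_pos, ?_⟩, ?_⟩
  · ext z
    rw [mem_sphere_iff_norm]
    constructor
    · rintro ⟨t, rfl⟩
      rw [hcurve t, add_sub_cancel_left, norm_div, ← htan, D.unit_speed, hnorm, div_one]
    · intro hz
      set w := (z - (D.curve 0 - v / (c * Complex.I))) * (c * Complex.I) / v with hw
      have hw1 : ‖w‖ = 1 := by
        rw [hw, norm_div, norm_mul, hz, hnorm, hv, D.unit_speed]
        norm_num
      refine ⟨c * w.arg, ?_⟩
      rw [hcurve, ← mul_assoc, hcc, one_mul]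
      have hw2 := Complex.norm_mul_exp_arg_mul_I w
      rw [hw1, Complex.ofReal_one, one_mul] at hw2
      rw [hw2, hw, mul_div_cancel₀ _ hv0, mul_div_cancel_right₀ _ hcI]
      ring
  · intro x hx y hy hxy
    rw [hcurve x, hcurve y, add_right_inj, div_left_inj' hcI, mul_right_inj' hv0,
      Complex.exp_eq_exp_iff_exists_int] at hxy
    obtain ⟨k, hk⟩ := hxy
    have h1 := congrArg Complex.im hk
    simp at h1
    have hpi := Real.two_pi_pos
    have h2 : x - y = c * k * (2 * Real.pi) := by linear_combination c * h1 - (x - y) * hcc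
    have h3 : |x - y| < 2 * Real.pi := by
      rw [abs_lt]; constructor <;> linarith [hx.1, hx.2, hy.1, hy.2]
    rw [h2, abs_mul, abs_mul, habs, one_mul, abs_of_pos hpi, mul_lt_iff_lt_one_left hpi] at h3
    have h4 : k = 0 := by
      have : |k| < 1 := by exact_mod_cast h3
      exact Int.abs_lt_one_iff.1 this
    rw [h4] at h2
    simp at h2
    linarith

end KnotDiagram

/-! ### Elliptic functions and the pendulum equation -/

/-- The Jacobi amplitude with modulus `m`, the inverse function of `ellipticF · m`. -/
def jacobiAm (u m : ℝ) : ℝ := Function.invFun (fun φ => ellipticF φ m) u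

theorem jacobiSn_eq_sin (u m : ℝ) : jacobiSn u m = Real.sin (jacobiAm u m) := rfl

section Elliptic

variable {ξ : ℝ}

theorem one_sub_sq_mul_sin_sq_pos (hξ : ξ ∈ Ioo (0 : ℝ) 1) (φ : ℝ) :
    0 < 1 - ξ ^ 2 * Real.sin φ ^ 2 := by
  have h1 := Real.sin_sq_le_one φ
  have h2 : ξ ^ 2 < 1 := by nlinarith [hξ.1, hξ.2]
  nlinarith [sq_nonneg ξ, sq_nonneg (Real.sin φ)]

theorem continuous_ellipticF_integrand (hξ : ξ ∈ Ioo (0 : ℝ) 1) :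
    Continuous fun t => 1 / Real.sqrt (1 - ξ ^ 2 * Real.sin t ^ 2) :=
  continuous_const.div (by fun_prop) fun t =>
    (Real.sqrt_pos.2 (one_sub_sq_mul_sin_sq_pos hξ t)).ne'

theorem hasDerivAt_ellipticF (hξ : ξ ∈ Ioo (0 : ℝ) 1) (φ : ℝ) :
    HasDerivAt (fun φ => ellipticF φ ξ) (1 / Real.sqrt (1 - ξ ^ 2 * Real.sin φ ^ 2)) φ :=
  ((continuous_ellipticF_integrand hξ).integral_hasStrictDerivAt 0 φ).hasDerivAt

theorem ellipticF_zero : ellipticF 0 ξ = 0 := by simp [ellipticF]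

theorem strictMono_ellipticF (hξ : ξ ∈ Ioo (0 : ℝ) 1) : StrictMono fun φ => ellipticF φ ξ :=
  strictMono_of_deriv_pos fun φ => by
    rw [(hasDerivAt_ellipticF hξ φ).deriv]
    have := Real.sqrt_pos.2 (one_sub_sq_mul_sin_sq_pos hξ φ)
    positivity

theorem ellipticF_neg (hξ : ξ ∈ Ioo (0 : ℝ) 1) (φ : ℝ) : ellipticF (-φ) ξ = -ellipticF φ ξ := by
  have hd : ∀ t, HasDerivAt (fun t => ellipticF (-t) ξ + ellipticF t ξ) 0 t := fun t => by
    refine (((hasDerivAt_ellipticF hξ (-t)).comp t (hasDerivAt_neg t)).add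
      (hasDerivAt_ellipticF hξ t)).congr_deriv ?_
    simp
  have := is_const_of_deriv_eq_zero (fun t => (hd t).differentiableAt)
    (fun t => (hd t).deriv) φ 0
  simp only [neg_zero, ellipticF_zero, add_zero] at this
  linarith

theorem ellipticF_add_pi (hξ : ξ ∈ Ioo (0 : ℝ) 1) (φ : ℝ) :
    ellipticF (φ + Real.pi) ξ = ellipticF φ ξ + 2 * ellipticK ξ := by
  have hd : ∀ t, HasDerivAt (fun t => ellipticF (t + Real.pi) ξ - ellipticF t ξ) 0 t := fun t => by
    refine (((hasDerivAt_ellipticF hξ (t + Real.pi)).comp_add_const t Real.pi).sub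
      (hasDerivAt_ellipticF hξ t)).congr_deriv ?_
    simp
  have := is_const_of_deriv_eq_zero (fun t => (hd t).differentiableAt)
    (fun t => (hd t).deriv) φ (-(Real.pi / 2))
  simp only [ellipticF_neg hξ, show -(Real.pi / 2) + Real.pi = Real.pi / 2 by ring] at this
  rw [ellipticK]
  linarith

theorem ellipticK_pos (hξ : ξ ∈ Ioo (0 : ℝ) 1) : 0 < ellipticK ξ := by
  have := strictMono_ellipticF hξ Real.pi_div_two_pos
  simp only [ellipticF_zero] at this
  exact this

theorem le_ellipticF (hξ : ξ ∈ Ioo (0 : ℝ) 1) {φ : ℝ} (hφ : 0 ≤ φ) : φ ≤ ellipticF φ ξ := by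
  have hmono : Monotone fun t => ellipticF t ξ - t := by
    refine monotone_of_deriv_nonneg
      (fun t => ((hasDerivAt_ellipticF hξ t).sub (hasDerivAt_id t)).differentiableAt) fun t => ?_
    have hd : HasDerivAt (fun t => ellipticF t ξ - t) _ t :=
      (hasDerivAt_ellipticF hξ t).sub (hasDerivAt_id t)
    rw [hd.deriv, sub_nonneg]
    have h1 := one_sub_sq_mul_sin_sq_pos hξ t
    rw [le_div_iff₀ (Real.sqrt_pos.2 h1), one_mul, Real.sqrt_le_left zero_le_one, one_pow]
    nlinarith [mul_nonneg (sq_nonneg ξ) (sq_nonneg (Real.sin t))]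
  have := hmono hφ
  simp only [ellipticF_zero] at this
  linarith

theorem surjective_ellipticF (hξ : ξ ∈ Ioo (0 : ℝ) 1) :
    Function.Surjective fun φ => ellipticF φ ξ := by
  refine Continuous.surjective (continuous_iff_continuousAt.2 fun φ =>
    (hasDerivAt_ellipticF hξ φ).continuousAt) ?_ ?_
  · exact tendsto_atTop_mono' _ ((eventually_ge_atTop 0).mono fun φ hφ => le_ellipticF hξ hφ)
      tendsto_id
  · refine tendsto_atBot_mono' _ ((eventually_le_atBot 0).mono fun φ hφ => ?_) tendsto_id
    have := le_ellipticF hξ (neg_nonneg.2 hφ)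
    rw [ellipticF_neg hξ] at this
    simp only [id]
    linarith

theorem ellipticF_jacobiAm (hξ : ξ ∈ Ioo (0 : ℝ) 1) (u : ℝ) : ellipticF (jacobiAm u ξ) ξ = u :=
  Function.invFun_eq (surjective_ellipticF hξ u)

theorem jacobiAm_eq (hξ : ξ ∈ Ioo (0 : ℝ) 1) {u φ : ℝ} (h : ellipticF φ ξ = u) :
    jacobiAm u ξ = φ :=
  (strictMono_ellipticF hξ).injective (by simp only [ellipticF_jacobiAm hξ, h])

theorem strictMono_jacobiAm (hξ : ξ ∈ Ioo (0 : ℝ) 1) : StrictMono fun u => jacobiAm u ξ :=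
  fun u v huv => by
    rw [← (strictMono_ellipticF hξ).lt_iff_lt]
    simpa only [ellipticF_jacobiAm hξ] using huv

theorem continuous_jacobiAm (hξ : ξ ∈ Ioo (0 : ℝ) 1) : Continuous fun u => jacobiAm u ξ :=
  (strictMono_jacobiAm hξ).monotone.continuous_of_surjective fun φ =>
    ⟨ellipticF φ ξ, jacobiAm_eq hξ rfl⟩

theorem hasDerivAt_jacobiAm (hξ : ξ ∈ Ioo (0 : ℝ) 1) (u : ℝ) :
    HasDerivAt (fun u => jacobiAm u ξ)
      (Real.sqrt (1 - ξ ^ 2 * Real.sin (jacobiAm u ξ) ^ 2)) u := by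
  have hpos := Real.sqrt_pos.2 (one_sub_sq_mul_sin_sq_pos hξ (jacobiAm u ξ))
  have h := (hasDerivAt_ellipticF hξ (jacobiAm u ξ)).of_local_left_inverse
    (g := fun u => jacobiAm u ξ) (continuous_jacobiAm hξ).continuousAt (by positivity)
    (Eventually.of_forall fun v => ellipticF_jacobiAm hξ v)
  rwa [one_div, inv_inv] at h

theorem jacobiAm_zero (hξ : ξ ∈ Ioo (0 : ℝ) 1) : jacobiAm 0 ξ = 0 :=
  jacobiAm_eq hξ ellipticF_zero

theorem jacobiAm_ellipticK (hξ : ξ ∈ Ioo (0 : ℝ) 1) : jacobiAm (ellipticK ξ) ξ = Real.pi / 2 :=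
  jacobiAm_eq hξ rfl

theorem jacobiAm_neg (hξ : ξ ∈ Ioo (0 : ℝ) 1) (u : ℝ) : jacobiAm (-u) ξ = -jacobiAm u ξ :=
  jacobiAm_eq hξ (by rw [ellipticF_neg hξ, ellipticF_jacobiAm hξ])

theorem jacobiAm_add_two_mul_ellipticK (hξ : ξ ∈ Ioo (0 : ℝ) 1) (u : ℝ) :
    jacobiAm (u + 2 * ellipticK ξ) ξ = jacobiAm u ξ + Real.pi :=
  jacobiAm_eq hξ (by rw [ellipticF_add_pi hξ, ellipticF_jacobiAm hξ])

theorem ellipticF_nat_mul_two_pi (hξ : ξ ∈ Ioo (0 : ℝ) 1) (n : ℕ) :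
    ellipticF (n * (2 * Real.pi)) ξ = n * (4 * ellipticK ξ) := by
  induction n with
  | zero => simp [ellipticF_zero]
  | succ n ih =>
    rw [show ((n + 1 : ℕ) : ℝ) * (2 * Real.pi) = n * (2 * Real.pi) + Real.pi + Real.pi by
      push_cast; ring, ellipticF_add_pi hξ, ellipticF_add_pi hξ, ih]
    push_cast
    ring

end Elliptic

/-- The solution of the pendulum equation `α'' = -ω² sin α` that oscillates with the
amplitude `2 arcsin ξ` and passes upwards through `0` at time `0`. -/
def pendulumAngle (ξ ω t : ℝ) : ℝ := 2 * Real.arcsin (ξ * jacobiSn (ω * t) ξ)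

section Pendulum

variable {ξ : ℝ}

theorem abs_mul_sin_lt_one (hξ : ξ ∈ Ioo (0 : ℝ) 1) (φ : ℝ) : |ξ * Real.sin φ| < 1 := by
  rw [abs_mul, abs_of_pos hξ.1]
  nlinarith [Real.abs_sin_le_one φ, hξ.1, hξ.2, abs_nonneg (Real.sin φ)]

theorem sin_half_pendulumAngle (hξ : ξ ∈ Ioo (0 : ℝ) 1) (ω t : ℝ) :
    Real.sin (pendulumAngle ξ ω t / 2) = ξ * Real.sin (jacobiAm (ω * t) ξ) := by
  have h := abs_lt.1 (abs_mul_sin_lt_one hξ (jacobiAm (ω * t) ξ))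
  rw [pendulumAngle, mul_div_cancel_left₀ _ two_ne_zero, jacobiSn_eq_sin,
    Real.sin_arcsin h.1.le h.2.le]

theorem sin_pendulumAngle (hξ : ξ ∈ Ioo (0 : ℝ) 1) (ω t : ℝ) :
    Real.sin (pendulumAngle ξ ω t) = 2 * (ξ * Real.sin (jacobiAm (ω * t) ξ)) *
      Real.sqrt (1 - ξ ^ 2 * Real.sin (jacobiAm (ω * t) ξ) ^ 2) := by
  have h := abs_lt.1 (abs_mul_sin_lt_one hξ (jacobiAm (ω * t) ξ))
  rw [pendulumAngle, jacobiSn_eq_sin, Real.sin_two_mul, Real.sin_arcsin h.1.le h.2.le,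
    Real.cos_arcsin, mul_pow]

theorem cos_pendulumAngle (hξ : ξ ∈ Ioo (0 : ℝ) 1) (ω t : ℝ) :
    Real.cos (pendulumAngle ξ ω t) = 1 - 2 * ξ ^ 2 * Real.sin (jacobiAm (ω * t) ξ) ^ 2 := by
  have h := sin_half_pendulumAngle hξ ω t
  rw [show pendulumAngle ξ ω t = 2 * (pendulumAngle ξ ω t / 2) by ring, Real.cos_two_mul,
    Real.cos_sq', h]
  ring

theorem hasDerivAt_jacobiAm_mul (hξ : ξ ∈ Ioo (0 : ℝ) 1) (ω t : ℝ) :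
    HasDerivAt (fun t => jacobiAm (ω * t) ξ)
      (Real.sqrt (1 - ξ ^ 2 * Real.sin (jacobiAm (ω * t) ξ) ^ 2) * ω) t := by
  have h1 : HasDerivAt (fun t => ω * t) ω t := by simpa using (hasDerivAt_id t).const_mul ω
  exact (hasDerivAt_jacobiAm hξ (ω * t)).comp t h1

theorem hasDerivAt_pendulumAngle (hξ : ξ ∈ Ioo (0 : ℝ) 1) (ω t : ℝ) :
    HasDerivAt (pendulumAngle ξ ω) (2 * ξ * ω * Real.cos (jacobiAm (ω * t) ξ)) t := by
  have h := abs_lt.1 (abs_mul_sin_lt_one hξ (jacobiAm (ω * t) ξ))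
  have hpos := Real.sqrt_pos.2 (one_sub_sq_mul_sin_sq_pos hξ (jacobiAm (ω * t) ξ))
  have h1 : HasDerivAt (fun t => ξ * Real.sin (jacobiAm (ω * t) ξ)) _ t :=
    (hasDerivAt_jacobiAm_mul hξ ω t).sin.const_mul ξ
  have h2 : HasDerivAt (fun t => 2 * Real.arcsin (ξ * Real.sin (jacobiAm (ω * t) ξ))) _ t :=
    (HasDerivAt.comp t (Real.hasDerivAt_arcsin h.1.ne' h.2.ne) h1).const_mul 2
  refine h2.congr_deriv ?_
  rw [mul_pow]
  field_simp

theorem hasDerivAt_pendulumVelocity (hξ : ξ ∈ Ioo (0 : ℝ) 1) (ω t : ℝ) :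
    HasDerivAt (fun t => 2 * ξ * ω * Real.cos (jacobiAm (ω * t) ξ))
      (-ω ^ 2 * Real.sin (pendulumAngle ξ ω t)) t := by
  refine ((hasDerivAt_jacobiAm_mul hξ ω t).cos.const_mul (2 * ξ * ω)).congr_deriv ?_
  rw [sin_pendulumAngle hξ]
  ring

/-- Solutions of the pendulum equation are determined by position and velocity at one time. -/
theorem pendulum_unique {l : ℝ} {α κ β μ : ℝ → ℝ} (hα : ∀ t, HasDerivAt α (κ t) t)
    (hκ : ∀ t, HasDerivAt κ (-l * Real.sin (α t)) t) (hβ : ∀ t, HasDerivAt β (μ t) t)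
    (hμ : ∀ t, HasDerivAt μ (-l * Real.sin (β t)) t) {t₀ : ℝ} (h0 : α t₀ = β t₀)
    (h1 : κ t₀ = μ t₀) : α = β ∧ κ = μ := by
  set v : ℝ × ℝ → ℝ × ℝ := fun p => (p.2, -l * Real.sin p.1) with hv
  have hlip : LipschitzWith (max 1 (‖-l‖₊ * 1)) v := by
    have h2 : LipschitzWith (‖-l‖₊ * 1) fun p : ℝ × ℝ => -l * Real.sin p.1 := by
      have h3 : LipschitzWith 1 Real.sin := Real.lipschitzWith_sin
      have h4 : LipschitzWith ‖-l‖₊ fun x : ℝ => -l * x := lipschitzWith_smul (-l)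
      have h5 := (h4.comp h3).comp (LipschitzWith.prod_fst (α := ℝ) (β := ℝ))
      rw [mul_one] at h5
      exact h5
    exact LipschitzWith.prod_snd.prodMk h2
  have huniq : (fun t => (α t, κ t)) = fun t => (β t, μ t) :=
    ODE_solution_unique_univ (v := fun _ => v) (s := fun _ => univ) (t₀ := t₀)
      (fun _ => hlip.lipschitzOnWith) (fun t => ⟨(hα t).prodMk (hκ t), mem_univ _⟩)
      (fun t => ⟨(hβ t).prodMk (hμ t), mem_univ _⟩) (by simp only [h0, h1])
  exact ⟨funext fun t => congrArg Prod.fst (congrFun huniq t),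
    funext fun t => congrArg Prod.snd (congrFun huniq t)⟩

end Pendulum

/-! ### The tangent angle of a critical curve as a pendulum -/

namespace KnotDiagram

variable {D : KnotDiagram} {c : ℝ} {P : ℂ}

theorem norm_I_mul_div_norm (hP : P ≠ 0) : ‖Complex.I * P / ‖P‖‖ = 1 := by
  rw [norm_div, norm_mul, Complex.norm_I, Complex.norm_real, norm_norm, one_mul,
    div_self (norm_ne_zero_iff.2 hP)]

variable (D) in
theorem deriv_eq_mul_exp_arg {u : ℂ} (hu : ‖u‖ = 1) (t : ℝ) :
    deriv D.curve t = u * Complex.exp ((deriv D.curve t / u).arg * Complex.I) := by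
  have h := Complex.norm_mul_exp_arg_mul_I (deriv D.curve t / u)
  rw [norm_div, D.unit_speed, hu, div_one, Complex.ofReal_one, one_mul] at h
  rw [h, mul_div_cancel₀ _ (norm_ne_zero_iff.1 (by rw [hu]; exact one_ne_zero))]

/-- If the curvature is an affine function of position with gradient `P`, then the tangent angle
relative to the direction `i P` satisfies the pendulum equation. -/
theorem hasDerivAt_curvature_of_affine (hκ : ∀ t, D.curvature t = c + inner ℝ (D.curve t) P)
    (hP : P ≠ 0) {t a : ℝ}
    (ha : deriv D.curve t = Complex.I * P / ‖P‖ * Complex.exp (a * Complex.I)) :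
    HasDerivAt D.curvature (-‖P‖ * Real.sin a) t := by
  have h1 := ((D.hasDerivAt_curve t).inner ℝ (hasDerivAt_const t P)).const_add c
  rw [← funext hκ] at h1
  refine h1.congr_deriv ?_
  have hl : ‖P‖ ≠ 0 := norm_ne_zero_iff.2 hP
  rw [inner_zero_right, zero_add, Complex.inner, ha]
  have h2 : (starRingEnd ℂ) (Complex.I * P / ‖P‖ * Complex.exp (a * Complex.I)) * P =
      ‖P‖ * (-Complex.I * (Complex.exp (-(a * Complex.I)))) := by
    simp only [map_mul, map_div₀, Complex.conj_I, Complex.conj_ofReal, ← Complex.exp_conj]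
    rw [mul_neg]
    have h3 : (starRingEnd ℂ) P * P = (‖P‖ : ℂ) ^ 2 := by
      rw [← Complex.normSq_eq_conj_mul_self, Complex.normSq_eq_norm_sq]
      push_cast
      ring
    have hl' : (‖P‖ : ℂ) ≠ 0 := by exact_mod_cast hl
    field_simp
    linear_combination -h3
  rw [mul_comm P, h2, ← neg_mul, ← Complex.ofReal_neg, Complex.exp_mul_I, ← Complex.ofReal_cos,
    ← Complex.ofReal_sin, Complex.re_ofReal_mul]
  simp only [Complex.mul_re, Complex.neg_re, Complex.neg_im, Complex.I_re, Complex.I_im,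
    Complex.add_re, Complex.add_im, Complex.mul_im, Complex.ofReal_re, Complex.ofReal_im,
    Real.sin_neg]
  ring

/-- The curvature has a zero. Otherwise the curve would be that of a rotating pendulum, and the
derivative `cos α + ‖P‖ (sin α / κ)²` of the periodic function `sin α / κ` would show that the
curve does not close up. -/
theorem exists_curvature_eq_zero (hκ : ∀ t, D.curvature t = c + inner ℝ (D.curve t) P)
    (hP : P ≠ 0) : ∃ t, D.curvature t = 0 := by
  by_contra! hne
  have hl : 0 < ‖P‖ := norm_pos_iff.2 hP
  set u : ℂ := Complex.I * P / ‖P‖ with hu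
  have hu1 : ‖u‖ = 1 := norm_I_mul_div_norm hP
  have hu0 : u ≠ 0 := norm_ne_zero_iff.1 (by rw [hu1]; exact one_ne_zero)
  obtain ⟨α, -, hαd, hα⟩ := D.exists_tangent_angle (D.deriv_eq_mul_exp_arg hu1 0)
  have hκd : ∀ t, HasDerivAt D.curvature (-‖P‖ * Real.sin (α t)) t := fun t =>
    hasDerivAt_curvature_of_affine hκ hP (hα t)
  have hαc : Continuous α := continuous_iff_continuousAt.2 fun t => (hαd t).continuousAt
  have hκc := D.continuous_curvature
  have hsin : ∀ t, Real.sin (α t) = (deriv D.curve t / u).im := fun t => by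
    rw [hα t, mul_div_cancel_left₀ _ hu0, Complex.exp_ofReal_mul_I_im]
  have hcos : ∀ t, Real.cos (α t) = Complex.reCLM (u⁻¹ * deriv D.curve t) := fun t => by
    rw [hα t, inv_mul_cancel_left₀ hu0, Complex.reCLM_apply, Complex.exp_ofReal_mul_I_re]
  have hgd : ∀ t, HasDerivAt (fun t => Real.sin (α t) / D.curvature t)
      (Real.cos (α t) + ‖P‖ * (Real.sin (α t) / D.curvature t) ^ 2) t := fun t => by
    refine ((hαd t).sin.div (hκd t) (hne t)).congr_deriv ?_
    have := hne t
    field_simp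
    ring
  have hgc : Continuous fun t => Real.sin (α t) / D.curvature t :=
    continuous_iff_continuousAt.2 fun t => (hgd t).continuousAt
  have hgp : Function.Periodic (fun t => Real.sin (α t) / D.curvature t) (2 * Real.pi) :=
    fun t => by
      simp only [hsin, D.deriv_periodic t, D.curvature_periodic t]
  have h1 := intervalIntegral.integral_eq_sub_of_hasDerivAt (a := 0) (b := 2 * Real.pi)
    (fun t _ => hgd t) ((by fun_prop : Continuous _).intervalIntegrable _ _)
  have h2 : ∫ t in (0 : ℝ)..(2 * Real.pi), Real.cos (α t) = 0 := by
    simp only [hcos]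
    have hT := D.contDiff_deriv.continuous
    rw [ContinuousLinearMap.intervalIntegral_comp_comm _
      ((by fun_prop : Continuous _).intervalIntegrable _ _), intervalIntegral.integral_const_mul,
      D.integral_deriv_eq_zero, mul_zero, map_zero]
  have h3 := hgp 0
  simp only [zero_add] at h3
  rw [intervalIntegral.integral_add ((by fun_prop : Continuous _).intervalIntegrable _ _)
    ((by fun_prop : Continuous _).intervalIntegrable _ _), h2, intervalIntegral.integral_const_mul,
    h3, sub_self, zero_add, mul_eq_zero, or_iff_right hl.ne'] at h1
  have h4 : ∀ t, Real.sin (α t) = 0 := fun t => by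
    have := hgp.eq_zero_of_Icc (eq_zero_of_integral_sq_eq_zero hgc h1) t
    exact (div_eq_zero_iff.1 this).resolve_right (hne t)
  have h5 : Real.cos (α 0) * D.curvature 0 = 0 := by
    have h6 := (hαd 0).sin
    rw [funext h4] at h6
    exact h6.unique (hasDerivAt_const 0 0)
  have h6 := (mul_eq_zero.1 h5).resolve_right (hne 0)
  have h7 := Real.sin_sq_add_cos_sq (α 0)
  rw [h4 0, h6] at h7
  norm_num at h7

/-- The tangent angle is that of an oscillating pendulum. -/
theorem exists_pendulum (hκ : ∀ t, D.curvature t = c + inner ℝ (D.curve t) P) (hP : P ≠ 0) :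
    ∃ ξ ∈ Ioo (0 : ℝ) 1, ∃ t₀ : ℝ,
      (∀ t, deriv D.curve (t + t₀) = Complex.I * P / ‖P‖ *
        Complex.exp (pendulumAngle ξ (Real.sqrt ‖P‖) t * Complex.I)) ∧
      ∀ t, D.curvature (t + t₀) =
        2 * ξ * Real.sqrt ‖P‖ * Real.cos (jacobiAm (Real.sqrt ‖P‖ * t) ξ) := by
  obtain ⟨t₁, ht₁⟩ := exists_curvature_eq_zero hκ hP
  have hl : 0 < ‖P‖ := norm_pos_iff.2 hP
  set u : ℂ := Complex.I * P / ‖P‖ with hu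
  have hu1 : ‖u‖ = 1 := norm_I_mul_div_norm hP
  set α₁ := (deriv D.curve t₁ / u).arg with hα₁
  obtain ⟨α, hα1, hαd, hα⟩ := D.exists_tangent_angle (D.deriv_eq_mul_exp_arg hu1 t₁)
  have hκd : ∀ t, HasDerivAt D.curvature (-‖P‖ * Real.sin (α t)) t := fun t =>
    hasDerivAt_curvature_of_affine hκ hP (hα t)
  -- The pendulum is not at rest, as the curve would then be a straight line.
  have hsin : Real.sin α₁ ≠ 0 := by
    intro hs
    obtain ⟨-, h2⟩ := pendulum_unique hαd hκd (β := fun _ => α₁) (μ := fun _ => 0)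
      (fun t => hasDerivAt_const t _) (fun t => by simpa [hs] using hasDerivAt_const t (0 : ℝ))
      hα1 ht₁
    obtain ⟨t, ht⟩ := D.exists_curvature_ne_zero
    exact ht (congrFun h2 t)
  have hrange := Complex.arg_mem_Ioc (deriv D.curve t₁ / u)
  rw [← hα₁] at hrange
  have hlt : α₁ < Real.pi := lt_of_le_of_ne hrange.2 fun h => hsin (by rw [h, Real.sin_pi])
  have h0 : α₁ ≠ 0 := fun h => hsin (by rw [h, Real.sin_zero])
  set ω := Real.sqrt ‖P‖ with hω
  have hωpos : 0 < ω := Real.sqrt_pos.2 hl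
  have hω2 : ω ^ 2 = ‖P‖ := Real.sq_sqrt hl.le
  have hpi := Real.pi_pos
  -- At `t₁` the pendulum turns back, so `t₁` is a quarter period away from a zero of the angle.
  obtain ⟨ξ, hξ, s, hs1, hs2⟩ : ∃ ξ ∈ Ioo (0 : ℝ) 1, ∃ s : ℝ, pendulumAngle ξ ω s = α₁ ∧
      Real.cos (jacobiAm (ω * s) ξ) = 0 := by
    rcases lt_or_gt_of_ne h0 with hneg | hpos
    · have hξ : Real.sin (-α₁ / 2) ∈ Ioo (0 : ℝ) 1 := by
        refine ⟨Real.sin_pos_of_pos_of_lt_pi (by linarith) (by linarith [hrange.1]), ?_⟩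
        rw [← Real.sin_pi_div_two]
        exact Real.sin_lt_sin_of_lt_of_le_pi_div_two (by linarith) le_rfl (by linarith [hrange.1])
      refine ⟨Real.sin (-α₁ / 2), hξ, -ellipticK (Real.sin (-α₁ / 2)) / ω, ?_⟩
      rw [pendulumAngle, jacobiSn_eq_sin, mul_div_cancel₀ _ hωpos.ne', jacobiAm_neg hξ,
        jacobiAm_ellipticK hξ, Real.sin_neg, Real.sin_pi_div_two, Real.cos_neg,
        Real.cos_pi_div_two, mul_neg, mul_one, ← Real.sin_neg, Real.arcsin_sin
          (by linarith [hrange.1]) (by linarith)]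
      exact ⟨by ring, rfl⟩
    · have hξ : Real.sin (α₁ / 2) ∈ Ioo (0 : ℝ) 1 := by
        refine ⟨Real.sin_pos_of_pos_of_lt_pi (by linarith) (by linarith), ?_⟩
        rw [← Real.sin_pi_div_two]
        exact Real.sin_lt_sin_of_lt_of_le_pi_div_two (by linarith) le_rfl (by linarith)
      refine ⟨Real.sin (α₁ / 2), hξ, ellipticK (Real.sin (α₁ / 2)) / ω, ?_⟩
      rw [pendulumAngle, jacobiSn_eq_sin, mul_div_cancel₀ _ hωpos.ne',
        jacobiAm_ellipticK hξ, Real.sin_pi_div_two, Real.cos_pi_div_two, mul_one,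
        Real.arcsin_sin (by linarith) (by linarith)]
      exact ⟨by ring, rfl⟩
  obtain ⟨h2, h3⟩ := pendulum_unique (l := ‖P‖)
    (α := fun t => α (t + (t₁ - s))) (κ := fun t => D.curvature (t + (t₁ - s)))
    (fun t => (hαd _).comp_add_const t _) (fun t => (hκd _).comp_add_const t _)
    (hasDerivAt_pendulumAngle hξ ω)
    (fun t => by rw [← hω2]; exact hasDerivAt_pendulumVelocity hξ ω t) (t₀ := s)
    (by rw [add_sub_cancel, hα1, hs1]) (by rw [add_sub_cancel, ht₁, hs2, mul_zero])
  refine ⟨ξ, hξ, t₁ - s, fun t => ?_, fun t => congrFun h3 t⟩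
  rw [hα, ← congrFun h2 t]

/-- A closed curve whose tangent angle oscillates like a pendulum, and which is not a multiple
covering, contains one period of the oscillation. -/
theorem frequency_eq {ξ ω t₀ : ℝ} {u : ℂ} (hξ : ξ ∈ Ioo (0 : ℝ) 1) (hω : 0 < ω)
    (hT : ∀ t, deriv D.curve (t + t₀) = u * Complex.exp (pendulumAngle ξ ω t * Complex.I))
    (hκ : ∀ t, D.curvature (t + t₀) = 2 * ξ * ω * Real.cos (jacobiAm (ω * t) ξ)) :
    ω = 2 * ellipticK ξ / Real.pi := by
  have hpi := Real.pi_pos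
  have hK := ellipticK_pos hξ
  have hξ0 := hξ.1
  have h1 : Real.cos (jacobiAm (ω * (2 * Real.pi)) ξ) = 1 := by
    have h2 := hκ (2 * Real.pi)
    have h3 := hκ 0
    rw [add_comm, D.curvature_periodic, ← zero_add t₀, h3, mul_zero, jacobiAm_zero hξ,
      Real.cos_zero, mul_right_inj' (by positivity)] at h2
    exact h2.symm
  obtain ⟨n, hn⟩ := (Real.cos_eq_one_iff _).1 h1
  have hpos : 0 < jacobiAm (ω * (2 * Real.pi)) ξ := by
    rw [← jacobiAm_zero hξ]
    exact strictMono_jacobiAm hξ (by positivity)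
  have hn0 : 0 < n := by
    rw [← hn] at hpos
    have : (0 : ℝ) < n := by
      by_contra! hle
      nlinarith
    exact_mod_cast this
  lift n to ℕ using hn0.le
  have hn0' : 0 < n := by exact_mod_cast hn0
  have hnR : (0 : ℝ) < n := by exact_mod_cast hn0'
  have h2 : ω * (2 * Real.pi) = n * (4 * ellipticK ξ) := by
    rw [← ellipticF_nat_mul_two_pi hξ, ← ellipticF_jacobiAm hξ (ω * (2 * Real.pi)), ← hn]
    push_cast
    rfl
  have hper : Function.Periodic (deriv D.curve) (2 * Real.pi / n) := fun t => by
    have h3 : ω * (t - t₀ + 2 * Real.pi / n) =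
        ω * (t - t₀) + 2 * ellipticK ξ + 2 * ellipticK ξ := by
      field_simp
      linear_combination h2
    have h4 := hT (t - t₀ + 2 * Real.pi / n)
    have h5 := hT (t - t₀)
    rw [sub_add_cancel] at h5
    rw [show t - t₀ + 2 * Real.pi / n + t₀ = t + 2 * Real.pi / n by ring] at h4
    rw [h4, h5]
    simp only [pendulumAngle, jacobiSn_eq_sin, h3, jacobiAm_add_two_mul_ellipticK hξ,
      Real.sin_add_pi, neg_neg]
  have hn1 := D.eq_one_of_deriv_periodic hn0' hper
  rw [hn1] at h2
  rw [eq_div_iff hpi.ne']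
  push_cast at h2
  linarith

end KnotDiagram

/-! ### The shape of the `∞`-shaped curve -/

section PendulumCoordinate

variable {ξ : ℝ}

/-- The amplitude at time `t` for the frequency `2 K / π`, in which a period of the
oscillation lasts `2π`. -/
def normalizedAm (ξ t : ℝ) : ℝ := jacobiAm (2 * ellipticK ξ / Real.pi * t) ξ

theorem normalizedAm_strictMono (hξ : ξ ∈ Ioo (0 : ℝ) 1) : StrictMono (normalizedAm ξ) :=
  fun s t hst => strictMono_jacobiAm hξ
    (mul_lt_mul_of_pos_left hst (by have := ellipticK_pos hξ; have := Real.pi_pos; positivity))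

theorem normalizedAm_neg (hξ : ξ ∈ Ioo (0 : ℝ) 1) (t : ℝ) :
    normalizedAm ξ (-t) = -normalizedAm ξ t := by
  rw [normalizedAm, mul_neg, jacobiAm_neg hξ, normalizedAm]

theorem normalizedAm_add_pi (hξ : ξ ∈ Ioo (0 : ℝ) 1) (t : ℝ) :
    normalizedAm ξ (t + Real.pi) = normalizedAm ξ t + Real.pi := by
  rw [normalizedAm, mul_add, div_mul_cancel₀ _ Real.pi_ne_zero,
    jacobiAm_add_two_mul_ellipticK hξ, normalizedAm]

theorem normalizedAm_zero (hξ : ξ ∈ Ioo (0 : ℝ) 1) : normalizedAm ξ 0 = 0 := by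
  rw [normalizedAm, mul_zero, jacobiAm_zero hξ]

theorem normalizedAm_pi_div_two (hξ : ξ ∈ Ioo (0 : ℝ) 1) :
    normalizedAm ξ (Real.pi / 2) = Real.pi / 2 := by
  rw [normalizedAm, show 2 * ellipticK ξ / Real.pi * (Real.pi / 2) = ellipticK ξ by
    field_simp [Real.pi_ne_zero], jacobiAm_ellipticK hξ]

theorem normalizedAm_neg_pi_div_two (hξ : ξ ∈ Ioo (0 : ℝ) 1) :
    normalizedAm ξ (-(Real.pi / 2)) = -(Real.pi / 2) := by
  rw [normalizedAm_neg hξ, normalizedAm_pi_div_two hξ]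

theorem normalizedAm_three_pi_div_two (hξ : ξ ∈ Ioo (0 : ℝ) 1) :
    normalizedAm ξ (3 * Real.pi / 2) = 3 * Real.pi / 2 := by
  rw [show 3 * Real.pi / 2 = Real.pi / 2 + Real.pi by ring, normalizedAm_add_pi hξ,
    normalizedAm_pi_div_two hξ]

/-- The coordinate of a pendulum curve in the direction of its mean tangent is odd. -/
theorem pendulumCoordinate_odd (hξ : ξ ∈ Ioo (0 : ℝ) 1) {x : ℝ → ℝ} (hx0 : x 0 = 0)
    (hx : ∀ t, HasDerivAt x (1 - 2 * ξ ^ 2 * Real.sin (normalizedAm ξ t) ^ 2) t) (t : ℝ) :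
    x (-t) = -x t := by
  have hd : ∀ t, HasDerivAt (fun t => x (-t) + x t) 0 t := fun t => by
    refine (((hx (-t)).comp t (hasDerivAt_neg t)).add (hx t)).congr_deriv ?_
    rw [normalizedAm_neg hξ, Real.sin_neg]
    ring
  have := is_const_of_deriv_eq_zero (fun t => (hd t).differentiableAt)
    (fun t => (hd t).deriv) t 0
  simp only [neg_zero, hx0, add_zero] at this
  linarith

/-- If the coordinate has the period `2π`, then it has the period `π`. -/
theorem pendulumCoordinate_periodic (hξ : ξ ∈ Ioo (0 : ℝ) 1) {x : ℝ → ℝ}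
    (hx : ∀ t, HasDerivAt x (1 - 2 * ξ ^ 2 * Real.sin (normalizedAm ξ t) ^ 2) t)
    (hper : Function.Periodic x (2 * Real.pi)) : Function.Periodic x Real.pi := by
  have hd : ∀ t, HasDerivAt (fun t => x (t + Real.pi) - x t) 0 t := fun t => by
    refine (((hx (t + Real.pi)).comp_add_const t Real.pi).sub (hx t)).congr_deriv ?_
    rw [normalizedAm_add_pi hξ, Real.sin_add_pi]
    ring
  intro t
  have h1 := is_const_of_deriv_eq_zero (fun t => (hd t).differentiableAt)
    (fun t => (hd t).deriv) (t + Real.pi) t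
  have h2 := hper t
  simp only [show t + Real.pi + Real.pi = t + 2 * Real.pi by ring] at h1
  linarith

theorem pendulumCoordinate_pi_div_two (hξ : ξ ∈ Ioo (0 : ℝ) 1) {x : ℝ → ℝ} (hx0 : x 0 = 0)
    (hx : ∀ t, HasDerivAt x (1 - 2 * ξ ^ 2 * Real.sin (normalizedAm ξ t) ^ 2) t)
    (hper : Function.Periodic x (2 * Real.pi)) : x (Real.pi / 2) = 0 := by
  have h1 := pendulumCoordinate_periodic hξ hx hper (-(Real.pi / 2))
  rw [pendulumCoordinate_odd hξ hx0 hx, show -(Real.pi / 2) + Real.pi = Real.pi / 2 by ring] at h1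
  linarith

/-- Between two consecutive inflection points the coordinate vanishes only in the middle, since
its derivative vanishes only once in every quarter of a period. -/
theorem pendulumCoordinate_eq_zero (hξ : ξ ∈ Ioo (0 : ℝ) 1) {x : ℝ → ℝ} (hx0 : x 0 = 0)
    (hx : ∀ t, HasDerivAt x (1 - 2 * ξ ^ 2 * Real.sin (normalizedAm ξ t) ^ 2) t)
    (hper : Function.Periodic x (2 * Real.pi)) {a : ℝ}
    (ha : a ∈ Ioo (-(Real.pi / 2)) (Real.pi / 2)) (hxa : x a = 0) : a = 0 := by
  have hpos : ∀ a ∈ Ioo 0 (Real.pi / 2), x a ≠ 0 := by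
    intro a ha hxa
    have hc : Continuous x := continuous_iff_continuousAt.2 fun t => (hx t).continuousAt
    obtain ⟨b, hb, hb0⟩ := exists_hasDerivAt_eq_zero ha.1 hc.continuousOn (hx0.trans hxa.symm)
      fun t _ => hx t
    obtain ⟨d, hd, hd0⟩ := exists_hasDerivAt_eq_zero ha.2 hc.continuousOn
      (hxa.trans (pendulumCoordinate_pi_div_two hξ hx0 hx hper).symm) fun t _ => hx t
    have hbd : b < d := hb.2.trans hd.1
    have h1 := normalizedAm_strictMono hξ hbd
    have h2 := normalizedAm_strictMono hξ hb.1
    have h3 := normalizedAm_strictMono hξ hd.2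
    rw [normalizedAm_zero hξ] at h2
    rw [normalizedAm_pi_div_two hξ] at h3
    have hpi := Real.pi_pos
    have h4 : Real.sin (normalizedAm ξ b) < Real.sin (normalizedAm ξ d) :=
      Real.sin_lt_sin_of_lt_of_le_pi_div_two (by linarith) h3.le h1
    have h5 : 0 < Real.sin (normalizedAm ξ b) :=
      Real.sin_pos_of_pos_of_lt_pi h2 (by linarith)
    have h6 := pow_lt_pow_left₀ h4 h5.le two_ne_zero
    have h7 : 0 < ξ ^ 2 := pow_pos hξ.1 2
    nlinarith
  rcases lt_trichotomy a 0 with h | h | h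
  · refine absurd ?_ (hpos (-a) ⟨by linarith, by linarith [ha.1]⟩)
    rw [pendulumCoordinate_odd hξ hx0 hx, hxa, neg_zero]
  · exact h
  · exact absurd hxa (hpos a ⟨h, ha.2⟩)

/-- On a half-open period that starts at an inflection point, and apart from the next inflection
point, a point of the pendulum curve is determined by `cos φ` (which is proportional to
the coordinate orthogonal to the mean tangent) and the coordinate `x`. -/
theorem eq_of_pendulumCoordinate_eq (hξ : ξ ∈ Ioo (0 : ℝ) 1) {x : ℝ → ℝ} (hx0 : x 0 = 0)
    (hx : ∀ t, HasDerivAt x (1 - 2 * ξ ^ 2 * Real.sin (normalizedAm ξ t) ^ 2) t)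
    (hper : Function.Periodic x (2 * Real.pi)) {a b : ℝ}
    (ha : a ∈ Ico (-(Real.pi / 2)) (3 * Real.pi / 2)) (ha' : a ≠ Real.pi / 2)
    (hb : b ∈ Ico (-(Real.pi / 2)) (3 * Real.pi / 2)) (hb' : b ≠ Real.pi / 2)
    (hcos : Real.cos (normalizedAm ξ a) = Real.cos (normalizedAm ξ b)) (hab : x a = x b) :
    a = b := by
  have hpi := Real.pi_pos
  have hmono := normalizedAm_strictMono hξ
  have hbound : ∀ t ∈ Ico (-(Real.pi / 2)) (3 * Real.pi / 2),
      -(Real.pi / 2) ≤ normalizedAm ξ t ∧ normalizedAm ξ t < 3 * Real.pi / 2 := fun t ht => by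
    have h1 := hmono.monotone ht.1
    have h2 := hmono ht.2
    rw [normalizedAm_neg_pi_div_two hξ] at h1
    rw [normalizedAm_three_pi_div_two hξ] at h2
    exact ⟨h1, h2⟩
  obtain ⟨ha1, ha2⟩ := hbound a ha
  obtain ⟨hb1, hb2⟩ := hbound b hb
  obtain ⟨k, hk | hk⟩ := Real.cos_eq_cos_iff.1 hcos
  · have h1 : (k : ℝ) < 1 := by nlinarith
    have h2 : (-1 : ℝ) < k := by nlinarith
    have h3 : k = 0 := by
      have : k < 1 := by exact_mod_cast h1
      have : -1 < k := by exact_mod_cast h2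
      omega
    rw [h3] at hk
    simp only [Int.cast_zero, mul_zero, zero_mul, zero_add] at hk
    exact (hmono.injective hk).symm
  · have h1 : (k : ℝ) < 2 := by nlinarith
    have h2 : (-1 : ℝ) < k := by nlinarith
    have h3 : k = 0 ∨ k = 1 := by
      have : k < 2 := by exact_mod_cast h1
      have : -1 < k := by exact_mod_cast h2
      omega
    rcases h3 with rfl | rfl
    · have hba : b = -a := by
        refine hmono.injective ?_
        rw [normalizedAm_neg hξ, hk]
        simp
      have ha0 : x a = 0 := by
        rw [hba, pendulumCoordinate_odd hξ hx0 hx] at hab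
        linarith
      have hlt : a < Real.pi / 2 := lt_of_le_of_ne (by linarith [hb.1]) ha'
      have hgt : -(Real.pi / 2) < a := by
        rcases lt_or_eq_of_le ha.1 with h | h
        · exact h
        · exact absurd (by linarith) hb'
      have := pendulumCoordinate_eq_zero hξ hx0 hx hper ⟨hgt, hlt⟩ ha0
      rw [hba, this, neg_zero]
    · have hba : b = -a + Real.pi + Real.pi := by
        refine hmono.injective ?_
        rw [normalizedAm_add_pi hξ, normalizedAm_add_pi hξ, normalizedAm_neg hξ, hk]
        push_cast
        ring
      have hp := pendulumCoordinate_periodic hξ hx hper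
      have ha0 : x (a - Real.pi) = 0 := by
        rw [hba, hp, hp, pendulumCoordinate_odd hξ hx0 hx] at hab
        have := hp (a - Real.pi)
        rw [sub_add_cancel] at this
        linarith
      have := pendulumCoordinate_eq_zero hξ hx0 hx hper
        ⟨by linarith [hb.2], by linarith [ha.2]⟩ ha0
      linarith

end PendulumCoordinate

namespace KnotDiagram

variable {D : KnotDiagram} {c : ℝ} {P : ℂ}

/-- A diagram whose curvature is a non-constant affine function of position is the `∞`-shaped
curve passed once. The line that separates its loops is the level line of the curvature
through the inflection points, both of which lie over the double point. -/
theorem isInftyShapedPassedOnce_of_affine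
    (hκ : ∀ t, D.curvature t = c + inner ℝ (D.curve t) P) (hP : P ≠ 0) :
    D.IsInftyShapedPassedOnce := by
  obtain ⟨ξ, hξ, t₀, hT, hκ₀⟩ := exists_pendulum hκ hP
  have hl : 0 < ‖P‖ := norm_pos_iff.2 hP
  set u : ℂ := Complex.I * P / ‖P‖ with hu
  have hu1 : ‖u‖ = 1 := norm_I_mul_div_norm hP
  have hu0 : u ≠ 0 := norm_ne_zero_iff.1 (by rw [hu1]; exact one_ne_zero)
  have hωpos : 0 < Real.sqrt ‖P‖ := Real.sqrt_pos.2 hl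
  have hω := frequency_eq hξ hωpos hT hκ₀
  set ω := Real.sqrt ‖P‖
  have hpi := Real.pi_pos
  have hξ0 := hξ.1
  have hκ₁ : ∀ t, D.curvature t = 2 * ξ * ω * Real.cos (normalizedAm ξ (t - t₀)) := fun t => by
    have h1 := hκ₀ (t - t₀)
    rw [sub_add_cancel] at h1
    rw [h1, normalizedAm, ← hω]
  refine ⟨?_, ξ, hξ, u.arg, t₀, fun t => ?_⟩
  · -- The coordinate in the direction of the mean tangent.
    set x : ℝ → ℝ := fun t => (u⁻¹ * (D.curve (t + t₀) - D.curve t₀)).re with hxdef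
    have hx0 : x 0 = 0 := by simp [hxdef]
    have hx : ∀ t, HasDerivAt x (1 - 2 * ξ ^ 2 * Real.sin (normalizedAm ξ t) ^ 2) t := fun t => by
      have h1 := Complex.reCLM.hasFDerivAt.comp_hasDerivAt t
        ((((D.hasDerivAt_curve (t + t₀)).comp_add_const t t₀).sub_const (D.curve t₀)).const_mul u⁻¹)
      refine h1.congr_deriv ?_
      rw [hT, inv_mul_cancel_left₀ hu0, Complex.reCLM_apply, Complex.exp_ofReal_mul_I_re,
        cos_pendulumAngle hξ, hω, normalizedAm]
    have hxp : Function.Periodic x (2 * Real.pi) := fun t => by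
      simp only [hxdef, add_right_comm t, D.periodic (t + t₀)]
    have hxv : ∀ s, x (s - t₀) = (u⁻¹ * (D.curve s - D.curve t₀)).re := fun s => by
      simp only [hxdef, sub_add_cancel]
    have hκdiff : ∀ s τ, ((starRingEnd ℂ) P * (D.curve τ - D.curve s)).re =
        D.curvature τ - D.curvature s := fun s τ => by
      rw [hκ, hκ, Complex.inner, Complex.inner]
      simp
      ring
    have hκ0 : ∀ a, Real.cos (normalizedAm ξ a) = 0 → D.curvature (t₀ + a) = 0 := fun a ha => by
      rw [hκ₁, add_sub_cancel_left, ha, mul_zero]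
    have hκs : D.curvature (t₀ + -(Real.pi / 2)) = 0 := hκ0 _ (by
      rw [normalizedAm_neg_pi_div_two hξ, Real.cos_neg, Real.cos_pi_div_two])
    have hκt : D.curvature (t₀ + Real.pi / 2) = 0 := hκ0 _ (by
      rw [normalizedAm_pi_div_two hξ, Real.cos_pi_div_two])
    have hmono := normalizedAm_strictMono hξ
    refine ⟨t₀ + -(Real.pi / 2), t₀ + Real.pi / 2, by linarith, by linarith, ?_, ?_, P, ?_, ?_⟩
    · -- Both coordinates of the inflection points agree.
      have h1 : (u⁻¹ * (D.curve (t₀ + Real.pi / 2) - D.curve (t₀ + -(Real.pi / 2)))).re = 0 := by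
        have h2 := hxv (t₀ + Real.pi / 2)
        have h3 := hxv (t₀ + -(Real.pi / 2))
        rw [add_sub_cancel_left, pendulumCoordinate_pi_div_two hξ hx0 hx hxp] at h2
        rw [add_sub_cancel_left, pendulumCoordinate_odd hξ hx0 hx,
          pendulumCoordinate_pi_div_two hξ hx0 hx hxp] at h3
        rw [mul_sub, Complex.sub_re] at h2 h3 ⊢
        linarith
      have h2 := hκdiff (t₀ + -(Real.pi / 2)) (t₀ + Real.pi / 2)
      rw [hκs, hκt, sub_zero] at h2
      set d := D.curve (t₀ + Real.pi / 2) - D.curve (t₀ + -(Real.pi / 2)) with hd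
      have h3 : (starRingEnd ℂ) P = ‖P‖ * Complex.I * u⁻¹ := by
        have h4 : (starRingEnd ℂ) P * P = (‖P‖ : ℂ) ^ 2 := by
          rw [← Complex.normSq_eq_conj_mul_self, Complex.normSq_eq_norm_sq]
          push_cast
          ring
        have hl' : (‖P‖ : ℂ) ≠ 0 := by exact_mod_cast hl.ne'
        rw [eq_mul_inv_iff_mul_eq₀ hu0, hu]
        field_simp
        exact h4
      rw [h3, mul_assoc, mul_assoc, Complex.re_ofReal_mul, Complex.I_mul_re, mul_eq_zero,
        or_iff_right hl.ne', neg_eq_zero] at h2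
      have h4 : u⁻¹ * d = 0 := Complex.ext h1 h2
      rw [mul_eq_zero, or_iff_right (inv_ne_zero hu0), hd, sub_eq_zero] at h4
      exact h4.symm
    · rintro τ ⟨hτ, hτ'⟩ σ ⟨hσ, hσ'⟩ hτσ
      have hκeq : D.curvature τ = D.curvature σ := by rw [hκ, hκ, hτσ]
      rw [hκ₁, hκ₁, mul_right_inj' (by positivity)] at hκeq
      have hxeq : x (τ - t₀) = x (σ - t₀) := by rw [hxv, hxv, hτσ]
      have := eq_of_pendulumCoordinate_eq hξ hx0 hx hxp (a := τ - t₀) (b := σ - t₀)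
        ⟨by linarith [hτ.1], by linarith [hτ.2]⟩
        (fun h => hτ' (by rw [mem_singleton_iff]; linarith))
        ⟨by linarith [hσ.1], by linarith [hσ.2]⟩
        (fun h => hσ' (by rw [mem_singleton_iff]; linarith)) hκeq hxeq
      linarith
    · intro τ hτ
      rw [hκdiff, hκs, sub_zero, hκ₁]
      have h1 := hmono (show -(Real.pi / 2) < τ - t₀ by linarith [hτ.1])
      have h2 := hmono (show τ - t₀ < Real.pi / 2 by linarith [hτ.2])
      rw [normalizedAm_neg_pi_div_two hξ] at h1
      rw [normalizedAm_pi_div_two hξ] at h2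
      have := Real.cos_pos_of_mem_Ioo ⟨h1, h2⟩
      positivity
    · intro τ hτ
      rw [hκdiff, hκs, sub_zero, hκ₁]
      have h1 := hmono (show Real.pi / 2 < τ - t₀ by linarith [hτ.1])
      have h2 := hmono (show τ - t₀ < 3 * Real.pi / 2 by linarith [hτ.2])
      rw [normalizedAm_pi_div_two hξ] at h1
      rw [normalizedAm_three_pi_div_two hξ] at h2
      exact mul_neg_of_pos_of_neg (by positivity)
        (Real.cos_neg_of_pi_div_two_lt_of_lt h1 (by linarith))
  · have h1 := Complex.norm_mul_exp_arg_mul_I u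
    rw [hu1, Complex.ofReal_one, one_mul] at h1
    rw [hT, ← h1, ← Complex.exp_add, pendulumAngle, hω,
      show 2 * ellipticK ξ / Real.pi * t = 2 * ellipticK ξ * t / Real.pi by ring]
    congr 1
    rw [h1]
    push_cast
    ring

end KnotDiagram

end

theorem theorem2p12 (δ : ℝ) (hδ : 0 < δ) (D : KnotDiagram)
    (hD : D.IsCritical (KnotDiagram.totalEnergy δ)) :
    D.IsCirclePassedOnce ∨ D.IsInftyShapedPassedOnce ∨
      ∃ C : Set ℂ, D.IsAlternated C ∧ cycleArea C < ENNReal.ofReal δ := by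
  by_cases hcyc : ∃ C : Set ℂ, D.IsAlternated C ∧ cycleArea C < ENNReal.ofReal δ
  · exact Or.inr (Or.inr hcyc)
  · push Not at hcyc
    obtain ⟨c, P, hκ⟩ := KnotDiagram.exists_curvature_eq_affine hD
      fun C hC => (hcyc C hC).not_gt
    by_cases hP : P = 0
    · exact Or.inl (D.isCirclePassedOnce_of_curvature_eq (c := c) fun t => by
        rw [hκ, hP, inner_zero_right, add_zero])
    · exact Or.inr (Or.inl (KnotDiagram.isInftyShapedPassedOnce_of_affine hκ hP))
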